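/- A gadget has finitely many states and locations and is given by its transition graph, a finite directed graph on state/location pairs: an edge (transition) from $(s,a)$ to $(s',b)$ means that an agent may enter the gadget at $a$ when it is in state $s$ and exit at $b$, changing the state to $s'$. A gadget is a single-input input/output gadget if it has one input location $a$ such that every transition leads from $a$ to a location different from $a$ and in every state there is at least one transition from $a$; it may be nondeterministic. A system of $G$ consists of $n$ copies of $G$, an initial state for each copy, an undirected connection graph on the locations of the copies, and designated start and goal locations; the agent moves freely along edges of the connection graph and through copies by transitions available in their current states. One-player motion planning with $G$ is the problem of deciding, given an explicit description of a system of $G$, whether some sequence of moves brings the agent from the start location to the goal location. A controlled switching flow in a system of $G$ is a function $f$ from the transitions of the copies of $G$ to $\mathbb{N}$ such that (i) for each connected component $H$ of the connection graph, $\sum_{t\in H_i} f(t)-\sum_{t\in H_o} f(t)=[\text{start}\in H]-[\text{goal}\in H]$, where $H_i$ is the set of transitions entered from a location in $H$, $H_o$ is the set of transitions that exit at a location in $H$, and $[P]$ is $1$ if $P$ holds and $0$ otherwise, and (ii) for each copy there is a legal sequence of transitions from its initial state that uses each transition $t$ of the copy exactly $f(t)$ times. **Theorem.** Let $G$ be a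 single-input input/output gadget, possibly nondeterministic. Then one-player motion planning with $G$ is in NP. Moreover, controlled switching flows are certificates for it: 1. there is a polynomial-time algorithm that decides, given a system of $G$ and a function $f$ from the transitions of its copies to $\mathbb{N}$ (with values in binary), whether $f$ is a controlled switching flow; 2. if a system of $G$ has a controlled switching flow, then the goal location can be reached; 3. if the goal location can be reached in a system of $n$ copies of $G$, and $G$ has $k$ states, then there is a controlled switching flow with $f(t)\le n k^n$ for every transition $t$, and with binary description of length at most $p(N)$, where $N$ is the length of the description of the system and $p$ is a polynomial that depends only on $G$. -/

import Mathlib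

/-! ### Polynomial time and NP, over Mathlib's multi-stack Turing machines -/

namespace IOGadget

open Turing Computability

open Classical in
/-- The property `P` of the objects of type `α`, written as strings by `enc`, is decided by a
deterministic Turing machine in time polynomial in the length of the string. -/
def PolyTimeDecidable {α Γ : Type} (enc : α → List Γ) (P : α → Prop) : Prop :=
  Nonempty (TM2ComputableInPolyTime enc encodeBool (fun a => decide (P a)))

/-- A pair of strings as one string over the disjoint union of the two alphabets. -/
def pairString {Γ Δ : Type} (x : List Γ × List Δ) : List (Γ ⊕ Δ) :=
  x.1.map Sum.inl ++ x.2.map Sum.inr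

/-- The class NP: there are a verifier `V`, decidable in polynomial time on all pairs of strings,
and a polynomial `p` such that `x ∈ L` if and only if some certificate `w` (a string over a finite
alphabet `Δ`) of length at most `p (|x|)` makes `V` accept. -/
def InNP {Γ : Type} (L : Language Γ) : Prop :=
  ∃ (Δ : Type) (_ : Finite Δ) (V : List Γ × List Δ → Prop) (p : Polynomial ℕ),
    PolyTimeDecidable pairString V ∧
      ∀ x : List Γ, x ∈ L ↔ ∃ w : List Δ, w.length ≤ p.eval x.length ∧ V (x, w)

/-- A list of natural numbers as a string: every number in binary, followed by a comma. -/
def encodeNats (l : List ℕ) : List Γ' :=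
  l.flatMap fun m => encodingNatΓ'.encode m ++ [Γ'.comma]

/-! ### Gadgets -/

/-- A gadget with finitely many states and locations, given by its transition graph: a finite
directed graph on the state/location pairs, with edges (transitions) numbered by `Fin numTrans`.
The transition `t` with `src t = (s, a)` and `dst t = (s', b)` lets the agent enter at `a` when the
state is `s`, exit at `b`, and changes the state to `s'`. -/
structure Gadget where
  numStates : ℕ
  numLocs : ℕ
  numTrans : ℕ
  src : Fin numTrans → Fin numStates × Fin numLocs
  dst : Fin numTrans → Fin numStates × Fin numLocs
  /-- the transition graph has no repeated edges -/
  edge_injective : Function.Injective fun t => (src t, dst t)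

/-- `G` is an input/output gadget with set of input locations `I`, all others being outputs: every
traversal goes from an input to an output, and in every state there is at least one traversal from
every input. -/
def Gadget.IsInputOutputWith (G : Gadget) (I : Set (Fin G.numLocs)) : Prop :=
  (∀ t, (G.src t).2 ∈ I ∧ (G.dst t).2 ∉ I) ∧ ∀ s, ∀ a ∈ I, ∃ t, G.src t = (s, a)

/-- `G` is an input/output gadget with exactly one input location (it may be nondeterministic). -/
def Gadget.IsSingleInputOutput (G : Gadget) : Prop :=
  ∃ a, G.IsInputOutputWith {a}

/-! ### Systems of gadgets and one-player motion planning -/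

/-- A system of copies of `G`, with designated start and goal locations. A location of the system
is a pair of a copy and a location of `G`. -/
structure System (G : Gadget) where
  numCopies : ℕ
  /-- the initial state of each copy -/
  init : Fin numCopies → Fin G.numStates
  start : Fin numCopies × Fin G.numLocs
  goal : Fin numCopies × Fin G.numLocs
  /-- the edges of the connection graph -/
  edges : List ((Fin numCopies × Fin G.numLocs) × (Fin numCopies × Fin G.numLocs))

namespace System

variable {G : Gadget} (S : System G)

/-- The locations of the system. -/
abbrev Loc : Type := Fin S.numCopies × Fin G.numLocs

/-- The (undirected) connection graph on the locations of the system. -/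
def conn : SimpleGraph S.Loc :=
  SimpleGraph.fromRel fun a b => (a, b) ∈ S.edges

/-- A configuration: the location of the agent and the states of all copies. -/
abbrev Config : Type := S.Loc × (Fin S.numCopies → Fin G.numStates)

/-- One move of the agent: along an edge of the connection graph, or through a copy of the gadget
by a transition available in its current state. -/
inductive Step : S.Config → S.Config → Prop
  | wire (a b : S.Loc) (σ : Fin S.numCopies → Fin G.numStates) :
      S.conn.Adj a b → Step (a, σ) (b, σ)
  | traverse (g : Fin S.numCopies) (t : Fin G.numTrans) (σ : Fin S.numCopies → Fin G.numStates) :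
      (G.src t).1 = σ g →
        Step ((g, (G.src t).2), σ) ((g, (G.dst t).2), Function.update σ g (G.dst t).1)

/-- Some sequence of moves brings the agent from the start location, with all copies in their
initial states, to the goal location. -/
def GoalReachable : Prop :=
  ∃ σ, Relation.ReflTransGen S.Step (S.start, S.init) (S.goal, σ)

/-- The numbers that describe a system: the number of copies, their initial states, the start and
goal locations, and the endpoints of the edges of the connection graph. -/
def toNats : List ℕ :=
  S.numCopies :: (List.ofFn (fun g => (S.init g : ℕ)) ++
    [(S.start.1 : ℕ), (S.start.2 : ℕ), (S.goal.1 : ℕ), (S.goal.2 : ℕ)] ++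
    S.edges.flatMap fun e => [(e.1.1 : ℕ), (e.1.2 : ℕ), (e.2.1 : ℕ), (e.2.2 : ℕ)])

/-- The string that describes a system. -/
def encode : List Γ' := encodeNats S.toNats

/-! ### Controlled switching flows -/

/-- A natural number for each transition of each copy of the gadget. -/
abbrev Flow : Type := Fin S.numCopies → Fin G.numTrans → ℕ

/-- The string that lists the values of a flow. -/
def encodeFlow (f : S.Flow) : List Γ' :=
  encodeNats ((List.ofFn fun g => List.ofFn fun t => f g t).flatten)

end System

/-- Starting in state `s`, the gadget can perform the given transitions one after the other. -/
def Gadget.IsLegal (G : Gadget) : Fin G.numStates → List (Fin G.numTrans) → Prop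
  | _, [] => True
  | s, t :: ts => (G.src t).1 = s ∧ G.IsLegal (G.dst t).1 ts

namespace System

variable {G : Gadget} (S : System G)

open Classical in
/-- `f` is a controlled switching flow: for each connected component `H` of the connection graph,
the uses of transitions entered from `H` minus the uses of transitions that exit into `H` is
`[start ∈ H] - [goal ∈ H]`; and for each copy there is a legal sequence of transitions from its
initial state that uses each transition `t` exactly `f g t` times. -/
def IsControlledSwitchingFlow (f : S.Flow) : Prop :=
  (∀ H : S.conn.ConnectedComponent,
    ((∑ g, ∑ t, if S.conn.connectedComponentMk (g, (G.src t).2) = H then (f g t : ℤ) else 0) -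
      ∑ g, ∑ t, if S.conn.connectedComponentMk (g, (G.dst t).2) = H then (f g t : ℤ) else 0) =
    (if S.conn.connectedComponentMk S.start = H then 1 else 0) -
      (if S.conn.connectedComponentMk S.goal = H then 1 else 0)) ∧
  ∀ g, ∃ ts : List (Fin G.numTrans), G.IsLegal (S.init g) ts ∧ ∀ t, ts.count t = f g t

end System

/-- The string that describes a system together with a flow. -/
def encodeSystemFlow {G : Gadget} (x : (S : System G) × S.Flow) : List (Γ' ⊕ Γ') :=
  pairString (x.1.encode, x.1.encodeFlow x.2)

/-- One-player motion planning with `G`, as a language: the descriptions of the systems of copies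
of `G` in which the agent can reach the goal location. -/
def onePlayerMotionPlanning (G : Gadget) : Language Γ' :=
  {x | ∃ S : System G, S.encode = x ∧ S.GoalReachable}

/-! ### The descriptions are unambiguous -/

theorem encodeNats_injective : Function.Injective encodeNats := by
  have hc : ∀ m : ℕ, Γ'.comma ∉ encodingNatΓ'.encode m := by
    intro m h
    simp only [encodingNatΓ', List.mem_map] at h
    obtain ⟨b, _, hb⟩ := h
    cases hb
  have key : ∀ (u v a b : List Γ'), Γ'.comma ∉ u → Γ'.comma ∉ v →
      u ++ Γ'.comma :: a = v ++ Γ'.comma :: b → u = v ∧ a = b := by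
    intro u
    induction u with
    | nil =>
      intro v a b _ hv h
      cases v with
      | nil => simpa using h
      | cons y v =>
        simp only [List.nil_append, List.cons_append, List.cons.injEq] at h
        exact absurd (by simp [h.1]) hv
    | cons x u ih =>
      intro v a b hu hv h
      cases v with
      | nil =>
        simp only [List.nil_append, List.cons_append, List.cons.injEq] at h
        exact absurd (by simp [h.1]) hu
      | cons y v =>
        simp only [List.cons_append, List.cons.injEq] at h
        simp only [List.mem_cons, not_or] at hu hv
        obtain ⟨h1, h2⟩ := ih v a b hu.2 hv.2 h.2
        exact ⟨by rw [h.1, h1], h2⟩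
  intro l
  induction l with
  | nil =>
    intro l' h
    cases l' with
    | nil => rfl
    | cons m l' => simp [encodeNats] at h
  | cons k l ih =>
    intro l' h
    cases l' with
    | nil => simp [encodeNats] at h
    | cons m l' =>
      simp only [encodeNats, List.flatMap_cons, List.append_assoc, List.singleton_append] at h
      obtain ⟨h1, h2⟩ := key _ _ _ _ (hc k) (hc m) h
      rw [encodingNatΓ'.encode_injective h1, ih h2]

theorem System.encode_injective {G : Gadget} :
    Function.Injective (System.encode : System G → List Γ') := by
  rintro ⟨n, i, s, g, e⟩ ⟨n', i', s', g', e'⟩ h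
  have h := encodeNats_injective h
  simp only [System.toNats, List.cons.injEq] at h
  obtain ⟨rfl, h⟩ := h
  have h1 := List.append_inj h (by simp)
  have h2 := List.append_inj h1.1 (by simp)
  have hi : i = i' := by
    funext x
    exact Fin.ext (congrFun (List.ofFn_injective h2.1) x)
  have h3 := h2.2
  simp only [List.cons.injEq, and_true] at h3
  have hs : s = s' := Prod.ext (Fin.ext h3.1) (Fin.ext h3.2.1)
  have hg : g = g' := Prod.ext (Fin.ext h3.2.2.1) (Fin.ext h3.2.2.2)
  have he : ∀ e e' : List ((Fin n × Fin G.numLocs) × (Fin n × Fin G.numLocs)),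
      (e.flatMap fun e => [(e.1.1 : ℕ), (e.1.2 : ℕ), (e.2.1 : ℕ), (e.2.2 : ℕ)]) =
        (e'.flatMap fun e => [(e.1.1 : ℕ), (e.1.2 : ℕ), (e.2.1 : ℕ), (e.2.2 : ℕ)]) → e = e' := by
    intro e
    induction e with
    | nil => intro e' h; cases e' <;> simp_all
    | cons a e ih =>
      intro e' h
      cases e' with
      | nil => simp at h
      | cons b e' =>
        simp only [List.flatMap_cons, List.cons_append, List.nil_append, List.cons.injEq] at h
        obtain ⟨h1, h2, h3, h4, h5⟩ := h
        rw [ih e' h5, show a = b from Prod.ext (Prod.ext (Fin.ext h1) (Fin.ext h2))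
          (Prod.ext (Fin.ext h3) (Fin.ext h4))]
  rw [hi, hs, hg, he e e' h1.2]

theorem System.encodeFlow_injective {G : Gadget} (S : System G) :
    Function.Injective S.encodeFlow := by
  intro f f' h
  have h := encodeNats_injective h
  have h := List.eq_iff_flatten_eq.2 ⟨h, by simp [List.map_ofFn, Function.comp_def]⟩
  funext g t
  exact congrFun (List.ofFn_injective (congrFun (List.ofFn_injective h) g)) t

end IOGadget

open IOGadget

namespace IOGadget

open Turing Computability

/-! ### A structured language of stack programs -/

/-- The work stacks of a stack program. -/
inductive Stk
  | main
  | aux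
  | aux₂
  | cnt

instance : DecidableEq Stk := fun a b => by
  cases a <;> cases b <;> first | exact isTrue rfl | exact isFalse nofun

instance : Fintype Stk := ⟨{.main, .aux, .aux₂, .cnt}, fun k => by cases k <;> decide⟩

/-- The contents of the work stacks. -/
@[ext]
structure Stacks where
  main : List Bool
  aux : List Bool
  aux₂ : List Bool
  cnt : List Bool

namespace Stacks

/-- The content of a stack. -/
def get (S : Stacks) : Stk → List Bool
  | .main => S.main
  | .aux => S.aux
  | .aux₂ => S.aux₂
  | .cnt => S.cnt

/-- Replace the content of a stack. -/
def set (S : Stacks) : Stk → List Bool → Stacks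
  | .main, l => { S with main := l }
  | .aux, l => { S with aux := l }
  | .aux₂, l => { S with aux₂ := l }
  | .cnt, l => { S with cnt := l }

theorem get_set (S : Stacks) (k k' : Stk) (l : List Bool) :
    (S.set k l).get k' = if k' = k then l else S.get k' := by
  cases k <;> cases k' <;> rfl

@[simp] theorem set_get (S : Stacks) (k : Stk) : S.set k (S.get k) = S := by
  cases k <;> rfl

end Stacks

/-- Structured programs on the work stacks. `case k c₀ c₁ c₂` pops the stack `k` and continues with
`c₀`, `c₁` or `c₂` if the stack was empty, the symbol was `true`, or the symbol was `false`;
`loop k c` pops the stack `k` and executes `c` as long as the popped symbol is `true`. -/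
inductive Cmd
  | skip
  | push (k : Stk) (b : Bool)
  | seq (c d : Cmd)
  | case (k : Stk) (c₀ c₁ c₂ : Cmd)
  | loop (k : Stk) (c : Cmd)

/-- `Runs c S n S'`: the program `c` turns the stacks `S` into `S'` in `n` steps. -/
inductive Runs : Cmd → Stacks → ℕ → Stacks → Prop
  | skip (S) : Runs .skip S 1 S
  | push (k b S) : Runs (.push k b) S 1 (S.set k (b :: S.get k))
  | seq {c d S m S' n S₂} : Runs c S m S' → Runs d S' n S₂ → Runs (.seq c d) S (m + n + 1) S₂
  | case_nil {k c₀ c₁ c₂ S n S'} : S.get k = [] → Runs c₀ S n S' →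
      Runs (.case k c₀ c₁ c₂) S (n + 1) S'
  | case_true {k c₀ c₁ c₂ S n S' l} : S.get k = true :: l → Runs c₁ (S.set k l) n S' →
      Runs (.case k c₀ c₁ c₂) S (n + 1) S'
  | case_false {k c₀ c₁ c₂ S n S' l} : S.get k = false :: l → Runs c₂ (S.set k l) n S' →
      Runs (.case k c₀ c₁ c₂) S (n + 1) S'
  | loop_nil {k c S} : S.get k = [] → Runs (.loop k c) S 1 S
  | loop_false {k c S l} : S.get k = false :: l → Runs (.loop k c) S 1 (S.set k l)
  | loop_true {k c S m S' n S₂ l} : S.get k = true :: l → Runs c (S.set k l) m S' →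
      Runs (.loop k c) S' n S₂ → Runs (.loop k c) S (m + n + 1) S₂

/-! ### Compilation to Turing machines -/

/-- The continuations that occur while `c` is executed with the continuation `C` after it. -/
def Cmd.supp : Cmd → List Cmd → Set (List Cmd)
  | .skip, C => {.skip :: C}
  | .push k b, C => {.push k b :: C}
  | .seq c d, C => insert (.seq c d :: C) (c.supp (d :: C) ∪ d.supp C)
  | .case k c₀ c₁ c₂, C => insert (.case k c₀ c₁ c₂ :: C) (c₀.supp C ∪ c₁.supp C ∪ c₂.supp C)
  | .loop k c, C => insert (.loop k c :: C) (c.supp (.loop k c :: C))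

theorem Cmd.supp_finite (c : Cmd) : ∀ C, (c.supp C).Finite := by
  induction c with
  | skip => intro C; exact Set.finite_singleton _
  | push => intro C; exact Set.finite_singleton _
  | seq c d hc hd => intro C; exact ((hc _).union (hd _)).insert _
  | case k c₀ c₁ c₂ h₀ h₁ h₂ => intro C; exact (((h₀ _).union (h₁ _)).union (h₂ _)).insert _
  | loop k c h => intro C; exact (h _).insert _

theorem Cmd.mem_supp (c : Cmd) (C : List Cmd) : c :: C ∈ c.supp C := by
  cases c <;> simp [Cmd.supp]

namespace Compile

variable (A : Type)

/-- The alphabets: the input stack has the alphabet `A`. -/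
abbrev Alph : Option Stk → Type
  | none => A
  | some _ => Bool

variable {A}

/-- The stacks of the machine. -/
def stk (inp : List A) (S : Stacks) : ∀ k, List (Alph A k)
  | none => inp
  | some k => S.get k

theorem update_stk_some (inp : List A) (S : Stacks) (k : Stk) (l : List Bool) :
    Function.update (stk inp S) (some k) l = stk inp (S.set k l) := by
  funext k'
  rcases k' with _ | k'
  · rfl
  · by_cases h : k' = k
    · subst h
      simp [stk, Stacks.get_set]
    · rw [Function.update_of_ne (by simpa using h)]
      simp [stk, Stacks.get_set, h]

theorem update_stk_none (inp l : List A) (S : Stacks) :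
    Function.update (stk inp S) none l = stk l S := by
  funext k'
  rcases k' with _ | k'
  · simp [stk]
  · rw [Function.update_of_ne (by simp)]
    rfl

/-- The labels of the machine: `inl` for the phase that reads the input (`none` to begin,
`some none` to read a symbol, `some (some a)` to store the symbol `a`), `inr` for the
continuations in the set `X`. -/
abbrev Label (A : Type) (X : Set (List Cmd)) : Type := Option (Option A) ⊕ X

variable {X : Set (List Cmd)}

open Classical in
/-- The label of a continuation. -/
noncomputable def lbl (X : Set (List Cmd)) (C : List Cmd) : Label A X :=
  if h : C ∈ X then .inr ⟨C, h⟩ else .inl none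

/-- The internal memory: the symbol that was popped last. -/
abbrev Mem (A : Type) : Type := Option (Bool ⊕ A)

open TM2.Stmt in
/-- The statement that executes a continuation. -/
noncomputable def stmt (X : Set (List Cmd)) : List Cmd → TM2.Stmt (Alph A) (Label A X) (Mem A)
  | [] => load (fun _ => none) halt
  | .skip :: C => goto fun _ => lbl X C
  | .push k b :: C => push (some k) (fun _ => b) (goto fun _ => lbl X C)
  | .seq c d :: C => goto fun _ => lbl X (c :: d :: C)
  | .case k c₀ c₁ c₂ :: C => pop (some k) (fun _ o => o.map Sum.inl) (goto fun v => match v with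
      | some (.inl true) => lbl X (c₁ :: C)
      | some (.inl false) => lbl X (c₂ :: C)
      | _ => lbl X (c₀ :: C))
  | .loop k c :: C => pop (some k) (fun _ o => o.map Sum.inl) (goto fun v => match v with
      | some (.inl true) => lbl X (c :: .loop k c :: C)
      | _ => lbl X C)

open TM2.Stmt in
/-- Push a list of symbols on the main stack. -/
def pushAll (l : Label A X) : List Bool → TM2.Stmt (Alph A) (Label A X) (Mem A)
  | [] => goto fun _ => l
  | b :: bs => push (some .main) (fun _ => b) (pushAll l bs)

open TM2.Stmt in
/-- The program of the machine; `code a` is pushed on the main stack for the input symbol `a`. -/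
noncomputable def prog (code : A → List Bool) (c : Cmd) (X : Set (List Cmd)) :
    Label A X → TM2.Stmt (Alph A) (Label A X) (Mem A)
  | .inl none => push (some .main) (fun _ => false) (goto fun _ => .inl (some none))
  | .inl (some none) => pop none (fun _ o => o.map Sum.inr) (goto fun v => match v with
      | some (.inr a) => .inl (some (some a))
      | _ => lbl X [c])
  | .inl (some (some a)) => pushAll (.inl (some none)) (code a)
  | .inr C => stmt X C.1

section steps

variable {K Λ σ : Type} [DecidableEq K] {Γ : K → Type}

/-- `n` steps of a machine lead from one configuration to another. -/
def Steps (m : Λ → TM2.Stmt Γ Λ σ) (n : ℕ) (a b : TM2.Cfg Γ Λ σ) : Prop :=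
  (flip bind (TM2.step m))^[n] (some a) = some b

variable {m : Λ → TM2.Stmt Γ Λ σ}

theorem Steps.trans {n n' : ℕ} {a b c : TM2.Cfg Γ Λ σ} (h : Steps m n a b) (h' : Steps m n' b c) :
    Steps m (n + n') a c := by
  unfold Steps at *
  rw [add_comm, Function.iterate_add_apply, h, h']

theorem Steps.one {a b : TM2.Cfg Γ Λ σ} (h : TM2.step m a = some b) : Steps m 1 a b := h

theorem Steps.cast {n n' : ℕ} {a b : TM2.Cfg Γ Λ σ} (h : Steps m n a b) (e : n = n') :
    Steps m n' a b := e ▸ h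

end steps

theorem stepAux_pushAll (l : Label A X) (inp : List A) (v : Mem A) (bs : List Bool) :
    ∀ S : Stacks, TM2.stepAux (pushAll l bs) v (stk inp S) =
      ⟨some l, v, stk inp { S with main := bs.reverse ++ S.main }⟩ := by
  induction bs with
  | nil => intro S; rfl
  | cons b bs ih =>
    intro S
    have : Function.update (stk inp S) (some .main) (b :: stk inp S (some .main)) =
        stk inp (S.set .main (b :: S.main)) := update_stk_some _ _ _ _
    simp only [pushAll, TM2.stepAux]
    rw [this, ih]
    simp [Stacks.set]

theorem steps_of_runs (code : A → List Bool) (c₀ : Cmd) {c : Cmd} {S S' : Stacks} {n : ℕ}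
    (h : Runs c S n S') (inp : List A) :
    ∀ C v, c.supp C ⊆ X → C ∈ X → ∃ v', Steps (prog code c₀ X) n
      ⟨some (lbl X (c :: C)), v, stk inp S⟩ ⟨some (lbl X C), v', stk inp S'⟩ := by
  have hstmt : ∀ (c : Cmd) C, c.supp C ⊆ X →
      prog code c₀ X (lbl X (c :: C)) = stmt X (c :: C) := by
    intro c C hX
    have := hX (c.mem_supp C)
    simp [lbl, this, prog]
  induction h with
  | skip S =>
    intro C v hX hC
    refine ⟨v, Steps.one ?_⟩
    rw [TM2.step, hstmt _ _ hX]
    rfl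
  | push k b S =>
    intro C v hX hC
    refine ⟨v, Steps.one ?_⟩
    rw [TM2.step, hstmt _ _ hX]
    simp only [stmt, TM2.stepAux]
    congr 2
    exact update_stk_some _ _ _ _
  | @seq c d S m S' n S'' _ _ ih ih' =>
    intro C v hX hC
    have hd : d.supp C ⊆ X := fun x hx => hX (by simp [Cmd.supp, hx])
    have hc : c.supp (d :: C) ⊆ X := fun x hx => hX (by simp [Cmd.supp, hx])
    obtain ⟨v₁, h₁⟩ := ih (d :: C) v hc (hd (d.mem_supp C))
    obtain ⟨v₂, h₂⟩ := ih' C v₁ hd hC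
    refine ⟨v₂, Steps.cast (Steps.trans (Steps.one ?_) (h₁.trans h₂)) (by ring)⟩
    rw [TM2.step, hstmt _ _ hX]
    rfl
  | @case_nil k c₀ c₁ c₂ S n S' hk _ ih =>
    intro C v hX hC
    have hd : c₀.supp C ⊆ X := fun x hx => hX (by simp [Cmd.supp, hx])
    obtain ⟨v₁, h₁⟩ := ih C none hd hC
    refine ⟨v₁, Steps.cast (Steps.trans (Steps.one ?_) h₁) (by ring)⟩
    rw [TM2.step, hstmt _ _ hX]
    simp only [stmt, TM2.stepAux]
    rw [show stk inp S (some k) = ([] : List Bool) from hk, List.tail_nil,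
      update_stk_some, ← hk, Stacks.set_get, hk]
    rfl
  | @case_true k c₀ c₁ c₂ S n S' l hk _ ih =>
    intro C v hX hC
    have hd : c₁.supp C ⊆ X := fun x hx => hX (by simp [Cmd.supp, hx])
    obtain ⟨v₁, h₁⟩ := ih C (some (.inl true)) hd hC
    refine ⟨v₁, Steps.cast (Steps.trans (Steps.one ?_) h₁) (by ring)⟩
    rw [TM2.step, hstmt _ _ hX]
    simp only [stmt, TM2.stepAux]
    rw [show stk inp S (some k) = (true :: l : List Bool) from hk, List.tail_cons,
      update_stk_some]
    rfl
  | @case_false k c₀ c₁ c₂ S n S' l hk _ ih =>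
    intro C v hX hC
    have hd : c₂.supp C ⊆ X := fun x hx => hX (by simp [Cmd.supp, hx])
    obtain ⟨v₁, h₁⟩ := ih C (some (.inl false)) hd hC
    refine ⟨v₁, Steps.cast (Steps.trans (Steps.one ?_) h₁) (by ring)⟩
    rw [TM2.step, hstmt _ _ hX]
    simp only [stmt, TM2.stepAux]
    rw [show stk inp S (some k) = (false :: l : List Bool) from hk, List.tail_cons,
      update_stk_some]
    rfl
  | @loop_nil k c S hk =>
    intro C v hX hC
    refine ⟨none, Steps.one ?_⟩
    rw [TM2.step, hstmt _ _ hX]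
    simp only [stmt, TM2.stepAux]
    rw [show stk inp S (some k) = ([] : List Bool) from hk, List.tail_nil,
      update_stk_some, ← hk, Stacks.set_get, hk]
    rfl
  | @loop_false k c S l hk =>
    intro C v hX hC
    refine ⟨some (.inl false), Steps.one ?_⟩
    rw [TM2.step, hstmt _ _ hX]
    simp only [stmt, TM2.stepAux]
    rw [show stk inp S (some k) = (false :: l : List Bool) from hk, List.tail_cons,
      update_stk_some]
    rfl
  | @loop_true k c S m S' n S'' l hk _ _ ih ih' =>
    intro C v hX hC
    have hd : c.supp (.loop k c :: C) ⊆ X := fun x hx => hX (by simp [Cmd.supp, hx])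
    obtain ⟨v₁, h₁⟩ := ih _ (some (.inl true)) hd (hX (Cmd.mem_supp _ _))
    obtain ⟨v₂, h₂⟩ := ih' C v₁ hX hC
    refine ⟨v₂, Steps.cast (Steps.trans (Steps.one ?_) (h₁.trans h₂)) (by ring)⟩
    rw [TM2.step, hstmt _ _ hX]
    simp only [stmt, TM2.stepAux]
    rw [show stk inp S (some k) = (true :: l : List Bool) from hk, List.tail_cons,
      update_stk_some]
    rfl

theorem steps_read (code : A → List Bool) (c : Cmd) (l : List A) :
    ∀ (v : Mem A) (M : List Bool), ∃ v', Steps (prog code c X) (2 * l.length + 1)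
      ⟨some (.inl (some none)), v, stk l ⟨M, [], [], []⟩⟩
      ⟨some (lbl X [c]), v',
        stk [] ⟨l.foldl (fun M a => (code a).reverse ++ M) M, [], [], []⟩⟩ := by
  induction l with
  | nil =>
    intro v M
    refine ⟨none, Steps.one ?_⟩
    rw [TM2.step]
    simp only [prog, TM2.stepAux]
    rw [show stk ([] : List A) ⟨M, [], [], []⟩ none = [] from rfl, List.tail_nil,
      update_stk_none]
    rfl
  | cons a l ih =>
    intro v M
    obtain ⟨v', h⟩ := ih (some (.inr a)) ((code a).reverse ++ M)
    refine ⟨v', Steps.cast (Steps.trans (Steps.one (b := ⟨some (.inl (some (some a))),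
      some (.inr a), stk l ⟨M, [], [], []⟩⟩) ?_) (Steps.trans (Steps.one ?_) h))
      (by simp only [List.length_cons]; ring)⟩
    · rw [TM2.step]
      simp only [prog, TM2.stepAux]
      rw [show stk (a :: l) ⟨M, [], [], []⟩ none = a :: l from rfl, List.tail_cons,
        update_stk_none]
      rfl
    · rw [TM2.step]
      simp only [prog]
      rw [stepAux_pushAll]

end Compile

open Compile in
/-- A predicate that is decided by a stack program in polynomial time is decided by a Turing
machine in polynomial time. -/
theorem polyTimeDecidable_of_runs {A : Type} [Fintype A] (code : A → List Bool) (c : Cmd)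
    {α : Type} (e : α → List A) (Q : α → Prop) (p : Polynomial ℕ)
    (h : ∀ a, ∃ b : Bool, (b = true ↔ Q a) ∧ ∃ n ≤ p.eval (e a).length,
      Runs c ⟨(e a).foldl (fun M a => (code a).reverse ++ M) [false], [], [], []⟩ n
        ⟨[b], [], [], []⟩) :
    PolyTimeDecidable e Q := by
  classical
  let X : Set (List Cmd) := insert [] (c.supp [])
  have hX : X.Finite := (c.supp_finite []).insert _
  have : Fintype X := hX.fintype
  let tm : FinTM2 :=
    { K := Option Stk
      k₀ := none
      k₁ := some .main
      Γ := Alph A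
      Λ := Label A X
      main := .inl none
      σ := Mem A
      initialState := none
      Γk₀Fin := inferInstanceAs (Fintype A)
      m := prog code c X }
  have key : ∀ a, ∃ n ≤ p.eval (e a).length + 2 * (e a).length + 3, Steps (prog code c X) n
      ⟨some (.inl none), none, stk (e a) ⟨[], [], [], []⟩⟩
      ⟨none, none, stk [] ⟨[decide (Q a)], [], [], []⟩⟩ := by
    intro a
    obtain ⟨b, hb, n, hn, hr⟩ := h a
    have hb' : b = decide (Q a) := by
      rw [Bool.eq_iff_iff, hb, decide_eq_true_iff]
    subst hb'
    obtain ⟨v₁, h₁⟩ := steps_read (X := X) code c (e a) none [false]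
    obtain ⟨v₂, h₂⟩ := steps_of_runs (X := X) code c hr ([] : List A) [] v₁
      (Set.subset_insert _ _) (Set.mem_insert _ _)
    refine ⟨1 + ((2 * (e a).length + 1) + (n + 1)), by omega,
      Steps.trans (Steps.one ?_) (h₁.trans (h₂.trans (Steps.one ?_)))⟩
    · rw [TM2.step]
      simp only [prog, TM2.stepAux]
      congr 2
      exact update_stk_some _ _ _ _
    · rw [TM2.step]
      have : ([] : List Cmd) ∈ X := Set.mem_insert _ _
      simp only [lbl, this, dif_pos, prog, stmt, TM2.stepAux]
  refine ⟨{ tm := tm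
            inputAlphabet := Equiv.refl A
            outputAlphabet := Equiv.refl Bool
            time := p + 2 * Polynomial.X + 3
            outputsFun := fun a => ?_ }⟩
  choose n hn hs using key
  have h0 : initList tm (List.map (Equiv.refl A).invFun (e a)) =
      (⟨some (.inl none), none, stk (e a) ⟨[], [], [], []⟩⟩ : tm.Cfg) := by
    unfold initList
    congr 1
    funext k
    rcases k with _ | k
    · simp only [tm]
      simp [stk, Equiv.refl]
    · rw [dif_neg (by simp [tm])]
      cases k <;> rfl
  have h1 : haltList tm (List.map (Equiv.refl Bool).invFun (encodeBool (decide (Q a)))) =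
      (⟨none, none, stk [] ⟨[decide (Q a)], [], [], []⟩⟩ : tm.Cfg) := by
    unfold haltList
    congr 1
    funext k
    rcases k with _ | k
    · rw [dif_neg (by simp [tm])]
      rfl
    · by_cases hk : k = .main
      · subst hk
        simp only [tm]
        simp [stk, Equiv.refl, Stacks.get, encodeBool]
      · rw [dif_neg (by simpa [tm] using hk)]
        cases k <;> first | rfl | exact absurd rfl hk
  refine ⟨⟨n a, ?_⟩, ?_⟩
  · rw [h0]
    simp only [Option.map_some]
    rw [h1]
    exact hs a
  · have := hn a
    simp only [Polynomial.eval_add, Polynomial.eval_mul, Polynomial.eval_X,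
      Polynomial.eval_ofNat]
    exact this

/-! ### Data and their codes -/

/-- Binary trees, the data on which polynomial-time functions are defined. -/
inductive BT
  | nil
  | node (l r : BT)

namespace BT

/-- The prefix code of a tree. -/
def code : BT → List Bool
  | nil => [false]
  | node l r => true :: (code l ++ code r)

/-- The number of nodes of a tree. -/
def size : BT → ℕ
  | nil => 1
  | node l r => 1 + size l + size r

theorem one_le_size (t : BT) : 1 ≤ t.size := by
  cases t <;> simp only [size] <;> omega

theorem length_code (t : BT) : t.code.length = t.size := by
  induction t with
  | nil => rfl
  | node l r hl hr => simp [code, size, hl, hr]; omega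

end BT

/-- Types whose elements are encoded by trees. -/
class TEnc (α : Type) where
  enc : α → BT

open IOGadget.TEnc (enc)

section

variable {α β γ δ σ : Type} [TEnc α] [TEnc β] [TEnc γ] [TEnc δ] [TEnc σ]

/-- The size of the code of an element. -/
def sz (a : α) : ℕ := (enc a).size

/-- The code of an element as a string. -/
def code (a : α) : List Bool := (enc a).code

theorem one_le_sz (a : α) : 1 ≤ sz a := BT.one_le_size _

instance : TEnc Unit := ⟨fun _ => .nil⟩

instance : TEnc Bool := ⟨fun b => if b then .node .nil .nil else .nil⟩

instance : TEnc (α × β) := ⟨fun x => .node (enc x.1) (enc x.2)⟩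

/-- The code of a list. -/
def encList : List α → BT
  | [] => .nil
  | a :: l => .node (enc a) (encList l)

instance : TEnc (List α) := ⟨encList⟩

theorem sz_bool_le (b : Bool) : sz b ≤ 3 := by cases b <;> simp [sz, enc, BT.size]

@[simp] theorem sz_prod (x : α × β) : sz x = 1 + sz x.1 + sz x.2 := rfl

@[simp] theorem sz_nil : sz ([] : List α) = 1 := rfl

@[simp] theorem sz_cons (a : α) (l : List α) : sz (a :: l) = 1 + sz a + sz l := rfl

theorem code_prod (x : α × β) : code x = true :: (code x.1 ++ code x.2) := rfl

theorem code_nil : code ([] : List α) = [false] := rfl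

theorem code_cons (a : α) (l : List α) : code (a :: l) = true :: (code a ++ code l) := rfl

theorem sz_list (l : List α) : sz l = 1 + (l.map fun a => 1 + sz a).sum := by
  induction l with
  | nil => rfl
  | cons a l ih => simp only [sz_cons, ih, List.map_cons, List.sum_cons]; omega

theorem sz_append (l l' : List α) : sz (l ++ l') + 1 = sz l + sz l' := by
  simp only [sz_list, List.map_append, List.sum_append]; omega

theorem length_lt_sz (l : List α) : l.length < sz l := by
  induction l with
  | nil => simp
  | cons a l ih => simp only [sz_cons, List.length_cons]; omega

theorem sz_mem_lt {a : α} {l : List α} (h : a ∈ l) : sz a < sz l := by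
  induction l with
  | nil => cases h
  | cons b l ih =>
    rcases List.mem_cons.1 h with rfl | h
    · simp only [sz_cons]; have := one_le_sz l; omega
    · have := ih h; simp only [sz_cons]; omega

theorem sz_le_of_forall {l : List α} {k m : ℕ} (hk : l.length ≤ k) (h : ∀ a ∈ l, sz a ≤ m) :
    sz l ≤ 1 + k * (1 + m) := by
  rw [sz_list]
  have : (l.map fun a => 1 + sz a).sum ≤ (l.map fun a => 1 + sz a).length • (1 + m) := by
    apply List.sum_le_card_nsmul
    intro x hx
    obtain ⟨a, ha, rfl⟩ := List.mem_map.1 hx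
    have := h a ha
    omega
  rw [List.length_map, smul_eq_mul] at this
  have h2 : l.length * (1 + m) ≤ k * (1 + m) := Nat.mul_le_mul_right _ hk
  omega

/-! ### Polynomial bounds -/

theorem polynomial_eval_mono (p : Polynomial ℕ) {m n : ℕ} (h : m ≤ n) : p.eval m ≤ p.eval n := by
  rw [Polynomial.eval_eq_sum, Polynomial.eval_eq_sum]
  exact Finset.sum_le_sum fun i _ => Nat.mul_le_mul_left _ (Nat.pow_le_pow_left h i)

/-- `m a` is bounded by a polynomial in the size of `a`. -/
def PB (m : α → ℕ) : Prop :=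
  ∃ p : Polynomial ℕ, ∀ a, m a ≤ p.eval (sz a)

theorem PB.mono {m m' : α → ℕ} (h : PB m') (hm : ∀ a, m a ≤ m' a) : PB m :=
  let ⟨p, hp⟩ := h
  ⟨p, fun a => (hm a).trans (hp a)⟩

theorem PB.const (n : ℕ) : PB fun _ : α => n := ⟨Polynomial.C n, fun _ => by simp⟩

theorem PB.sz : PB (sz : α → ℕ) := ⟨Polynomial.X, fun _ => by simp⟩

theorem PB.add {m m' : α → ℕ} (h : PB m) (h' : PB m') : PB fun a => m a + m' a := by
  obtain ⟨p, hp⟩ := h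
  obtain ⟨q, hq⟩ := h'
  exact ⟨p + q, fun a => by rw [Polynomial.eval_add]; exact add_le_add (hp a) (hq a)⟩

theorem PB.mul {m m' : α → ℕ} (h : PB m) (h' : PB m') : PB fun a => m a * m' a := by
  obtain ⟨p, hp⟩ := h
  obtain ⟨q, hq⟩ := h'
  exact ⟨p * q, fun a => by rw [Polynomial.eval_mul]; exact Nat.mul_le_mul (hp a) (hq a)⟩

theorem PB.eval {m : α → ℕ} (h : PB m) (p : Polynomial ℕ) : PB fun a => p.eval (m a) := by
  obtain ⟨q, hq⟩ := h
  exact ⟨p.comp q, fun a => by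
    rw [Polynomial.eval_comp]; exact polynomial_eval_mono p (hq a)⟩

theorem PB.comp {m : β → ℕ} {f : α → β} (hm : PB m) (hf : PB fun a => IOGadget.sz (f a)) :
    PB fun a => m (f a) := by
  obtain ⟨p, hp⟩ := hm
  exact (hf.eval p).mono fun a => hp (f a)

/-! ### Running stack programs -/

/-- The program `c` turns `S` into `S'` in at most `n` steps. -/
def RunsIn (c : Cmd) (S : Stacks) (n : ℕ) (S' : Stacks) : Prop := ∃ m ≤ n, Runs c S m S'

namespace RunsIn

variable {c d c₀ c₁ c₂ : Cmd} {S S' S'' : Stacks} {m n N : ℕ} {k : Stk} {l : List Bool}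

theorem mono (h : RunsIn c S n S') (hn : n ≤ N) : RunsIn c S N S' :=
  let ⟨m, hm, h⟩ := h
  ⟨m, hm.trans hn, h⟩

theorem skip (S : Stacks) : RunsIn .skip S 1 S := ⟨1, le_rfl, .skip S⟩

theorem push (k : Stk) (b : Bool) (S : Stacks) : RunsIn (.push k b) S 1 (S.set k (b :: S.get k)) :=
  ⟨1, le_rfl, .push k b S⟩

theorem seq (h : RunsIn c S m S') (h' : RunsIn d S' n S'') :
    RunsIn (.seq c d) S (m + n + 1) S'' :=
  let ⟨i, hi, h⟩ := h
  let ⟨j, hj, h'⟩ := h'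
  ⟨i + j + 1, by omega, .seq h h'⟩

theorem case_true (hk : S.get k = true :: l) (h : RunsIn c₁ (S.set k l) n S') :
    RunsIn (.case k c₀ c₁ c₂) S (n + 1) S' :=
  let ⟨i, hi, h⟩ := h
  ⟨i + 1, by omega, .case_true hk h⟩

theorem case_false (hk : S.get k = false :: l) (h : RunsIn c₂ (S.set k l) n S') :
    RunsIn (.case k c₀ c₁ c₂) S (n + 1) S' :=
  let ⟨i, hi, h⟩ := h
  ⟨i + 1, by omega, .case_false hk h⟩

theorem loop_false (hk : S.get k = false :: l) : RunsIn (.loop k c) S 1 (S.set k l) :=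
  ⟨1, le_rfl, .loop_false hk⟩

theorem loop_true (hk : S.get k = true :: l) (h : RunsIn c (S.set k l) m S')
    (h' : RunsIn (.loop k c) S' n S'') : RunsIn (.loop k c) S (m + n + 1) S'' :=
  let ⟨i, hi, h⟩ := h
  let ⟨j, hj, h'⟩ := h'
  ⟨i + j + 1, by omega, .loop_true hk h h'⟩

end RunsIn

/-- Every symbol preceded by the symbol `true`. -/
def flagged (l : List Bool) : List Bool := l.flatMap fun b => [true, b]

/-- The stack `A` with a string stored on top. -/
def stored (l A : List Bool) : List Bool := flagged l.reverse ++ false :: A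

namespace Cmd

/-- Store a symbol on both auxiliary stacks. -/
def store (b : Bool) : Cmd :=
  .seq (.push .aux b) (.seq (.push .aux true) (.seq (.push .aux₂ b) (.push .aux₂ true)))

/-- The body of the loop of `scan`. -/
def scanBody : Cmd :=
  .case .main .skip (.seq (.store true) (.seq (.push .cnt true) (.push .cnt true))) (.store false)

/-- Move a tree from the main stack to both auxiliary stacks. -/
def scan : Cmd :=
  .seq (.push .aux false) (.seq (.push .aux₂ false) (.seq (.push .cnt false)
    (.seq (.push .cnt true) (.loop .cnt scanBody))))

/-- Move the stored string from the stack `k` to the main stack. -/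
def restore (k : Stk) : Cmd := .loop k (.case k .skip (.push .main true) (.push .main false))

/-- Remove the stored string from the stack `k`. -/
def discard (k : Stk) : Cmd := .loop k (.case k .skip .skip .skip)

/-- Move a tree from the main stack to the first auxiliary stack. -/
def move : Cmd := .seq scan (discard .aux₂)

/-- Remove a tree from the main stack. -/
def drop : Cmd := .seq move (discard .aux)

/-- Duplicate a tree on the main stack. -/
def dup : Cmd := .seq scan (.seq (restore .aux) (restore .aux₂))

end Cmd

theorem runsIn_scan_loop (t : BT) : ∀ (M A B C : List Bool) (n : ℕ) (S' : Stacks),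
    RunsIn (.loop .cnt Cmd.scanBody)
      ⟨M, flagged t.code.reverse ++ A, flagged t.code.reverse ++ B, C⟩ n S' →
    RunsIn (.loop .cnt Cmd.scanBody) ⟨t.code ++ M, A, B, true :: C⟩ (n + 20 * t.size) S' := by
  have hstore : ∀ b M A B C, RunsIn (.store b) ⟨M, A, B, C⟩ 7
      ⟨M, true :: b :: A, true :: b :: B, C⟩ := fun b M A B C =>
    (RunsIn.push _ _ _).seq ((RunsIn.push _ _ _).seq ((RunsIn.push _ _ _).seq (RunsIn.push _ _ _)))
  induction t with
  | nil =>
    intro M A B C n S' h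
    exact (RunsIn.loop_true rfl (RunsIn.case_false (l := M) rfl (hstore _ _ _ _ _)) h).mono
      (by simp only [BT.size]; omega)
  | node l r hl hr =>
    intro M A B C n S' h
    have e : ∀ A, flagged (BT.node l r).code.reverse ++ A =
        flagged r.code.reverse ++ (flagged l.code.reverse ++ true :: true :: A) := by
      intro A
      simp [BT.code, flagged]
    rw [e, e] at h
    have h2 := hl _ _ _ _ _ _ (hr _ _ _ _ _ _ h)
    rw [show (BT.node l r).code ++ M = true :: (l.code ++ (r.code ++ M)) by simp [BT.code]]
    exact (RunsIn.loop_true rfl (RunsIn.case_true rfl ((hstore _ _ _ _ _).seq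
      ((RunsIn.push _ _ _).seq (RunsIn.push _ _ _)))) h2).mono
      (by simp only [BT.size]; omega)

theorem runsIn_scan (t : BT) (M A B C : List Bool) :
    RunsIn .scan ⟨t.code ++ M, A, B, C⟩ (9 + 20 * t.size)
      ⟨M, stored t.code A, stored t.code B, C⟩ :=
  ((RunsIn.push _ _ _).seq ((RunsIn.push _ _ _).seq ((RunsIn.push _ _ _).seq
    ((RunsIn.push _ _ _).seq (runsIn_scan_loop t M (false :: A) (false :: B) (false :: C) 1 _
      (RunsIn.loop_false rfl)))))).mono (by omega)

theorem runsIn_restore_aux_aux (l : List Bool) : ∀ M A B C : List Bool,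
    RunsIn (.restore .aux) ⟨M, flagged l ++ false :: A, B, C⟩ (1 + 3 * l.length)
      ⟨l.reverse ++ M, A, B, C⟩ := by
  induction l with
  | nil => intro M A B C; exact RunsIn.loop_false rfl
  | cons b l ih =>
    intro M A B C
    have : RunsIn (.case .aux .skip (.push .main true) (.push .main false))
        ⟨M, b :: (flagged l ++ false :: A), B, C⟩ 2 ⟨b :: M, flagged l ++ false :: A, B, C⟩ := by
      cases b
      · exact RunsIn.case_false rfl (RunsIn.push _ _ _)
      · exact RunsIn.case_true rfl (RunsIn.push _ _ _)
    have h := RunsIn.loop_true (S := ⟨M, true :: b :: (flagged l ++ false :: A), B, C⟩) rfl this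
      (ih (b :: M) A B C)
    refine RunsIn.mono ?_ (le_of_eq ?_ : 2 + (1 + 3 * l.length) + 1 ≤ _)
    · simpa [Cmd.restore, flagged] using h
    · simp only [List.length_cons]; ring

theorem runsIn_restore_aux₂_aux (l : List Bool) : ∀ M A B C : List Bool,
    RunsIn (.restore .aux₂) ⟨M, A, flagged l ++ false :: B, C⟩ (1 + 3 * l.length)
      ⟨l.reverse ++ M, A, B, C⟩ := by
  induction l with
  | nil => intro M A B C; exact RunsIn.loop_false rfl
  | cons b l ih =>
    intro M A B C
    have : RunsIn (.case .aux₂ .skip (.push .main true) (.push .main false))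
        ⟨M, A, b :: (flagged l ++ false :: B), C⟩ 2 ⟨b :: M, A, flagged l ++ false :: B, C⟩ := by
      cases b
      · exact RunsIn.case_false rfl (RunsIn.push _ _ _)
      · exact RunsIn.case_true rfl (RunsIn.push _ _ _)
    have h := RunsIn.loop_true (S := ⟨M, A, true :: b :: (flagged l ++ false :: B), C⟩) rfl this
      (ih (b :: M) A B C)
    refine RunsIn.mono ?_ (le_of_eq ?_ : 2 + (1 + 3 * l.length) + 1 ≤ _)
    · simpa [Cmd.restore, flagged] using h
    · simp only [List.length_cons]; ring

theorem runsIn_discard_flagged (k : Stk) (l : List Bool) : ∀ (S : Stacks) (A : List Bool),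
    S.get k = flagged l ++ false :: A →
    RunsIn (.discard k) S (1 + 3 * l.length) (S.set k A) := by
  induction l with
  | nil => intro S A h; exact RunsIn.loop_false h
  | cons b l ih =>
    intro S A h
    have hset : ∀ (S : Stacks) l l', (S.set k l).set k l' = S.set k l' := by
      intro S l l'; cases k <;> rfl
    have hget : ∀ (S : Stacks) l, (S.set k l).get k = l := fun S l => by simp [Stacks.get_set]
    have : RunsIn (.case k .skip .skip .skip) (S.set k (b :: (flagged l ++ false :: A))) 2
        (S.set k (flagged l ++ false :: A)) := by
      cases b
      · exact RunsIn.case_false (hget _ _) (by rw [hset]; exact RunsIn.skip _)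
      · exact RunsIn.case_true (hget _ _) (by rw [hset]; exact RunsIn.skip _)
    have h' := RunsIn.loop_true (l := b :: (flagged l ++ false :: A))
      (by rw [h]; simp [flagged]) this (ih _ A (hget _ _))
    rw [hset] at h'
    exact h'.mono (by simp only [List.length_cons]; omega)

theorem runsIn_restore_aux (t : BT) (M A B C : List Bool) :
    RunsIn (.restore .aux) ⟨M, stored t.code A, B, C⟩ (1 + 3 * t.size) ⟨t.code ++ M, A, B, C⟩ := by
  have := runsIn_restore_aux_aux t.code.reverse M A B C
  rwa [List.reverse_reverse, List.length_reverse, t.length_code] at this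

theorem runsIn_restore_aux₂ (t : BT) (M A B C : List Bool) :
    RunsIn (.restore .aux₂) ⟨M, A, stored t.code B, C⟩ (1 + 3 * t.size) ⟨t.code ++ M, A, B, C⟩ := by
  have := runsIn_restore_aux₂_aux t.code.reverse M A B C
  rwa [List.reverse_reverse, List.length_reverse, t.length_code] at this

theorem runsIn_discard (k : Stk) (t : BT) (S : Stacks) (A : List Bool)
    (h : S.get k = stored t.code A) : RunsIn (.discard k) S (1 + 3 * t.size) (S.set k A) := by
  have := runsIn_discard_flagged k _ S A h
  rwa [List.length_reverse, t.length_code] at this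

theorem runsIn_move (t : BT) (M A B C : List Bool) :
    RunsIn .move ⟨t.code ++ M, A, B, C⟩ (11 + 23 * t.size) ⟨M, stored t.code A, B, C⟩ :=
  ((runsIn_scan t M A B C).seq (runsIn_discard .aux₂ t _ B rfl)).mono (by omega)

theorem runsIn_drop (t : BT) (M A B C : List Bool) :
    RunsIn .drop ⟨t.code ++ M, A, B, C⟩ (13 + 26 * t.size) ⟨M, A, B, C⟩ :=
  ((runsIn_move t M A B C).seq (runsIn_discard .aux t _ A rfl)).mono (by omega)

theorem runsIn_dup (t : BT) (M A B C : List Bool) :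
    RunsIn .dup ⟨t.code ++ M, A, B, C⟩ (13 + 26 * t.size) ⟨t.code ++ (t.code ++ M), A, B, C⟩ :=
  ((runsIn_scan t M A B C).seq ((runsIn_restore_aux t _ _ _ _).seq
    (runsIn_restore_aux₂ t _ _ _ _))).mono (by omega)

/-! ### Polynomial-time functions -/

/-- `c` computes `f` on the top of the main stack in time `T`. -/
def Computes (c : Cmd) (T : α → ℕ) (f : α → β) : Prop :=
  ∀ a M A B C, RunsIn c ⟨code a ++ M, A, B, C⟩ (T a) ⟨code (f a) ++ M, A, B, C⟩

/-- `f` is computed by a stack program in polynomial time. -/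
def PT (f : α → β) : Prop :=
  PB (fun a => sz (f a)) ∧ ∃ c T, PB T ∧ Computes c T f

theorem PT.pb {f : α → β} (hf : PT f) : PB fun a => sz (f a) := hf.1

theorem PT.of_enc_eq {f : α → β} {g : α → γ} (hg : PT g) (h : ∀ a, enc (f a) = enc (g a)) :
    PT f := by
  obtain ⟨hs, c, T, hT, hc⟩ := hg
  refine ⟨hs.mono fun a => le_of_eq (congrArg BT.size (h a)), c, T, hT, fun a M A B C => ?_⟩
  have := hc a M A B C
  rwa [show code (g a) = code (f a) from congrArg BT.code (h a).symm] at this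

theorem PT.id : PT fun a : α => a :=
  ⟨PB.sz, .skip, fun _ => 1, PB.const 1, fun _ _ _ _ _ => RunsIn.skip _⟩

theorem PT.comp {g : β → γ} {f : α → β} (hg : PT g) (hf : PT f) : PT fun a => g (f a) := by
  obtain ⟨hs, c, T, hT, hc⟩ := hf
  obtain ⟨hs', c', T', hT', hc'⟩ := hg
  exact ⟨hs'.comp hs, .seq c c', fun a => T a + T' (f a) + 1,
    (hT.add (hT'.comp hs)).add (PB.const 1),
    fun a M A B C => (hc a M A B C).seq (hc' (f a) M A B C)⟩

theorem PT.pair {f : α → β} {g : α → γ} (hf : PT f) (hg : PT g) : PT fun a => (f a, g a) := by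
  obtain ⟨hs, c, T, hT, hc⟩ := hf
  obtain ⟨hs', c', T', hT', hc'⟩ := hg
  refine ⟨((PB.const 1).add hs).add hs', .seq .dup (.seq c (.seq .move (.seq c'
    (.seq (.restore .aux) (.push .main true))))),
    fun a => (13 + 26 * sz a) + (T a + ((11 + 23 * sz (f a)) + (T' a +
      ((1 + 3 * sz (f a)) + 1 + 1) + 1) + 1) + 1) + 1, ?_, fun a M A B C => ?_⟩
  · have h1 : ∀ n k, PB fun a => n + k * sz (f a) := fun n k =>
      (PB.const n).add ((PB.const k).mul hs)
    exact (((PB.const 13).add ((PB.const 26).mul PB.sz)).add ((hT.add (((h1 _ _).add ((hT'.add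
      (((h1 _ _).add (PB.const 1)).add (PB.const 1))).add (PB.const 1))).add (PB.const 1))).add
      (PB.const 1))).add (PB.const 1)
  · have h := (runsIn_dup (enc a) M A B C).seq ((hc a _ A B C).seq ((runsIn_move (enc (f a)) _ A B C).seq
      ((hc' a M _ B C).seq ((runsIn_restore_aux (enc (f a)) _ A B C).seq (RunsIn.push .main true _)))))
    have e : code (f a, g a) ++ M = true :: (code (f a) ++ (code (g a) ++ M)) := by
      simp [code_prod]
    rw [e]
    exact h

theorem PT.fst' : PT fun x : α × β => x.1 := by
  refine ⟨PB.sz.mono fun x => by simp only [sz_prod]; omega, .case .main .skip (.seq .move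
    (.seq .drop (.restore .aux))) .skip, fun x => 28 + 26 * sz x + 26 * sz x, ?_, ?_⟩
  · exact ((PB.const 28).add ((PB.const 26).mul PB.sz)).add ((PB.const 26).mul PB.sz)
  · rintro ⟨a, b⟩ M A B C
    have h := (runsIn_move (enc a) (code b ++ M) A B C).seq ((runsIn_drop (enc b) M _ B C).seq
      (runsIn_restore_aux (enc a) M A B C))
    have e : code (a, b) ++ M = true :: (code a ++ (code b ++ M)) := by simp [code_prod]
    rw [e]
    refine (RunsIn.case_true rfl h).mono ?_
    simp only [sz_prod]
    simp only [sz]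
    omega

theorem PT.snd' : PT fun x : α × β => x.2 := by
  refine ⟨PB.sz.mono fun x => by simp only [sz_prod]; omega, .case .main .skip .drop .skip,
    fun x => 14 + 26 * sz x, ?_, ?_⟩
  · exact (PB.const 14).add ((PB.const 26).mul PB.sz)
  · rintro ⟨a, b⟩ M A B C
    have e : code (a, b) ++ M = true :: (code a ++ (code b ++ M)) := by simp [code_prod]
    rw [e]
    refine (RunsIn.case_true rfl (runsIn_drop (enc a) (code b ++ M) A B C)).mono ?_
    simp only [sz_prod]
    simp only [sz]
    omega

theorem PT.fst {f : α → β × γ} (hf : PT f) : PT fun a => (f a).1 := PT.fst'.comp hf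

theorem PT.snd {f : α → β × γ} (hf : PT f) : PT fun a => (f a).2 := PT.snd'.comp hf

/-- Push a string on the main stack. -/
def Cmd.pushAll : List Bool → Cmd
  | [] => .skip
  | b :: l => .seq (.pushAll l) (.push .main b)

theorem runsIn_pushAll (l : List Bool) (M A B C : List Bool) :
    RunsIn (.pushAll l) ⟨M, A, B, C⟩ (1 + 2 * l.length) ⟨l ++ M, A, B, C⟩ := by
  induction l with
  | nil => exact RunsIn.skip _
  | cons b l ih =>
    exact (ih.seq (RunsIn.push .main b _)).mono (by simp only [List.length_cons]; omega)

theorem PT.const (b : β) : PT fun _ : α => b := by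
  refine ⟨PB.const _, .seq .drop (.pushAll (code b)),
    fun a => 13 + 26 * sz a + (1 + 2 * (code b).length) + 1, ?_, fun a M A B C =>
    (runsIn_drop (enc a) M A B C).seq (runsIn_pushAll _ _ _ _ _)⟩
  exact (((PB.const 13).add ((PB.const 26).mul PB.sz)).add (PB.const _)).add (PB.const 1)

/-- Branching on the head of a pair whose first component is a list. -/
theorem PT.branch {l : α → List β} {x : α → γ} {f : γ → δ} {g : (β × List β) × γ → δ}
    (hl : PT l) (hx : PT x) (hf : PT f) (hg : PT g) :
    PT fun a => match l a with
      | [] => f (x a)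
      | b :: t => g ((b, t), x a) := by
  have h1 : PT fun y : List β × γ => match y.1 with
      | [] => f y.2
      | b :: t => g ((b, t), y.2) := by
    obtain ⟨hs, c, T, hT, hc⟩ := hf.comp (PT.snd' (α := Unit))
    obtain ⟨hs', c', T', hT', hc'⟩ := hg
    obtain ⟨p, hp⟩ := hs
    obtain ⟨p', hp'⟩ := hs'
    obtain ⟨q, hq⟩ := hT
    obtain ⟨q', hq'⟩ := hT'
    refine ⟨⟨p + p', ?_⟩, .case .main .skip (.case .main .skip
      (.seq (.push .main true) (.seq (.push .main true) c'))
      (.seq (.push .main false) (.seq (.push .main true) c))) .skip,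
      fun y => q.eval (sz y) + q'.eval (sz y) + 6, ⟨q + q' + 6, fun a => by simp⟩, ?_⟩
    · rintro ⟨_ | ⟨b, t⟩, z⟩
      · have := hp ((), z)
        simp only [Polynomial.eval_add] at this ⊢
        exact this.trans (Nat.le_add_right _ _)
      · have := hp' ((b, t), z)
        simp only [Polynomial.eval_add] at this ⊢
        exact this.trans (Nat.le_add_left _ _)
    · rintro ⟨_ | ⟨b, t⟩, z⟩ M A B C
      · have h := hc ((), z) M A B C
        have h1 : RunsIn (.case .main .skip (.seq (.push .main true) (.seq (.push .main true) c'))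
            (.seq (.push .main false) (.seq (.push .main true) c)))
            ⟨false :: (code z ++ M), A, B, C⟩ _ ⟨code (f z) ++ M, A, B, C⟩ :=
          RunsIn.case_false rfl ((RunsIn.push .main false ⟨code z ++ M, A, B, C⟩).seq
            ((RunsIn.push .main true ⟨false :: (code z ++ M), A, B, C⟩).seq h))
        have h' := RunsIn.case_true (c₀ := .skip) (c₂ := .skip) (k := .main)
          (S := ⟨code (([] : List β), z) ++ M, A, B, C⟩) rfl h1
        refine h'.mono ?_
        have h2 := hq ((), z)
        have h3 : sz ((), z) = sz (([] : List β), z) := rfl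
        rw [h3] at h2
        beta_reduce
        omega
      · have h := hc' ((b, t), z) M A B C
        have e : code ((b, t), z) ++ M = true :: true :: ((code b ++ code t) ++ code z ++ M) := by
          simp [code_prod]
        rw [e] at h
        have h1 : RunsIn (.case .main .skip (.seq (.push .main true) (.seq (.push .main true) c'))
            (.seq (.push .main false) (.seq (.push .main true) c)))
            ⟨true :: ((code b ++ code t) ++ code z ++ M), A, B, C⟩ _
            ⟨code (g ((b, t), z)) ++ M, A, B, C⟩ :=
          RunsIn.case_true rfl ((RunsIn.push .main true
              ⟨(code b ++ code t) ++ code z ++ M, A, B, C⟩).seq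
            ((RunsIn.push .main true ⟨true :: ((code b ++ code t) ++ code z ++ M), A, B, C⟩).seq h))
        have h' := RunsIn.case_true (c₀ := .skip) (c₂ := .skip) (k := .main)
          (S := ⟨code (b :: t, z) ++ M, A, B, C⟩) rfl h1
        refine h'.mono ?_
        have h2 := hq' ((b, t), z)
        have h3 : sz ((b, t), z) = sz (b :: t, z) := rfl
        rw [h3] at h2
        beta_reduce
        omega
  exact h1.comp (hl.pair hx)

/-- A list is followed by a test whether it is empty. -/
def Cmd.test : Cmd :=
  .case .main .skip (.case .main .skip
    (.seq (.push .main true) (.seq (.push .main true) (.push .cnt true)))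
    (.seq (.push .main false) (.seq (.push .main true) (.push .cnt false)))) .skip

theorem runsIn_test_nil (x : γ) (M A B C : List Bool) :
    RunsIn .test ⟨code (([] : List β), x) ++ M, A, B, C⟩ 7
      ⟨code (([] : List β), x) ++ M, A, B, false :: C⟩ :=
  RunsIn.case_true rfl (RunsIn.case_false rfl ((RunsIn.push .main false _).seq
    ((RunsIn.push .main true _).seq (RunsIn.push .cnt false _))))

theorem runsIn_test_cons (b : β) (t : List β) (x : γ) (M A B C : List Bool) :
    RunsIn .test ⟨code (b :: t, x) ++ M, A, B, C⟩ 7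
      ⟨code (b :: t, x) ++ M, A, B, true :: C⟩ :=
  RunsIn.case_true rfl (RunsIn.case_true rfl ((RunsIn.push .main true _).seq
    ((RunsIn.push .main true _).seq (RunsIn.push .cnt true _))))

/-- Recursion along a list, if the intermediate results have polynomial size. -/
theorem PT.foldl {l : α → List β} {s₀ : α → σ} {h : α → σ → β → σ} (hl : PT l) (hs₀ : PT s₀)
    (hh : PT fun x : α × σ × β => h x.1 x.2.1 x.2.2)
    (hb : ∃ N : α → ℕ, PB N ∧ ∀ a l₁ l₂, l a = l₁ ++ l₂ → sz (l₁.foldl (h a) (s₀ a)) ≤ N a) :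
    PT fun a => (l a).foldl (h a) (s₀ a) := by
  obtain ⟨N, hN, hb⟩ := hb
  have hbody : PT fun x : (β × List β) × α × σ => (x.1.2, (x.2.1, h x.2.1 x.2.2 x.1.1)) := by
    have h1 : PT fun x : (β × List β) × α × σ => x.2.1 := PT.snd'.fst
    have h2 : PT fun x : (β × List β) × α × σ => x.2.2 := PT.snd'.snd
    have h3 : PT fun x : (β × List β) × α × σ => x.1.1 := PT.fst'.fst
    exact PT.fst'.snd.pair (h1.pair (hh.comp (h1.pair (h2.pair h3))))
  obtain ⟨-, c, T, hT, hc⟩ := hbody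
  obtain ⟨p, hp⟩ := hT
  have hstart : PT fun a => (l a, (a, s₀ a)) := hl.pair (PT.id.pair hs₀)
  let τ : α → ℕ := fun a => p.eval (3 + sz (l a) + sz a + N a) + 9
  have hτ : PB τ := (((((PB.const 3).add hl.pb).add PB.sz).add hN).eval p).add (PB.const 9)
  have hloop : PT fun a => (([] : List β), (a, (l a).foldl (h a) (s₀ a))) := by
    obtain ⟨-, c₀, T₀, hT₀, hc₀⟩ := hstart
    refine ⟨?_, .seq c₀ (.seq .test (.loop .cnt (.seq c .test))),
      fun a => T₀ a + (7 + (1 + sz (l a) * τ a) + 1) + 1, ?_, fun a M A B C => ?_⟩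
    · refine ((PB.const 3).add (PB.sz.add hN)).mono fun a => ?_
      have := hb a (l a) [] (by simp)
      simp only [sz_prod, sz_nil]
      omega
    · exact (hT₀.add (((PB.const 7).add ((PB.const 1).add (hl.pb.mul hτ))).add
        (PB.const 1))).add (PB.const 1)
    · refine (hc₀ a M A B C).seq ?_
      have key : ∀ l₂ l₁, l a = l₁ ++ l₂ →
          RunsIn (.seq .test (.loop .cnt (.seq c .test)))
            ⟨code (l₂, (a, l₁.foldl (h a) (s₀ a))) ++ M, A, B, C⟩
            (7 + (1 + l₂.length * τ a) + 1)
            ⟨code (([] : List β), (a, (l a).foldl (h a) (s₀ a))) ++ M, A, B, C⟩ := by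
        intro l₂
        induction l₂ with
        | nil =>
          intro l₁ e
          rw [List.append_nil] at e
          rw [e]
          exact ((runsIn_test_nil _ M A B C).seq (RunsIn.loop_false rfl)).mono (by omega)
        | cons b t ih =>
          intro l₁ e
          have h1 := hc ((b, t), (a, l₁.foldl (h a) (s₀ a))) M A B C
          have h2 := ih (l₁ ++ [b]) (by simp [e])
          rw [List.foldl_append] at h2
          obtain ⟨n, hn, h2⟩ := h2
          rcases h2 with _ | _ | @⟨_, _, _, m, S', n', _, h2, h3⟩
          have h4 := RunsIn.loop_true (k := .cnt)
            (S := ⟨code (b :: t, (a, l₁.foldl (h a) (s₀ a))) ++ M, A, B, true :: C⟩) (l := C) rfl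
            (h1.seq ⟨m, le_rfl, h2⟩) ⟨n', le_rfl, h3⟩
          refine ((runsIn_test_cons _ _ _ M A B C).seq h4).mono ?_
          have h5 := hp ((b, t), (a, l₁.foldl (h a) (s₀ a)))
          have h6 : sz ((b, t), (a, l₁.foldl (h a) (s₀ a))) ≤ 3 + sz (l a) + sz a + N a := by
            have h7 := hb a l₁ (b :: t) e
            have h8 := sz_append l₁ (b :: t)
            rw [← e] at h8
            have h9 := one_le_sz l₁
            simp only [sz_prod, sz_cons] at h8 ⊢
            omega
          have h7 := h5.trans (polynomial_eval_mono p h6)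
          have h8 : (b :: t).length * τ a = t.length * τ a + τ a := by
            rw [List.length_cons]; ring
          have h9 : τ a = p.eval (3 + sz (l a) + sz a + N a) + 9 := rfl
          omega
      refine (key (l a) [] rfl).mono ?_
      have := Nat.mul_le_mul_right (τ a) (length_lt_sz (l a)).le
      omega
  exact hloop.snd.snd

end

section

variable {α β γ δ σ : Type} [TEnc α] [TEnc β] [TEnc γ] [TEnc δ] [TEnc σ]

/-! ### Case distinctions -/

theorem PT.list_cases {l : α → List β} {f : α → δ} {g : α → β → List β → δ} (hl : PT l)
    (hf : PT f) (hg : PT fun x : α × β × List β => g x.1 x.2.1 x.2.2) :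
    PT fun a => match l a with
      | [] => f a
      | b :: t => g a b t :=
  PT.branch (g := fun y : (β × List β) × α => g y.2 y.1.1 y.1.2) hl PT.id hf
    (hg.comp (PT.snd'.pair PT.fst'))

theorem PT.tail {l : α → List β} (hl : PT l) : PT fun a => (l a).tail :=
  (PT.list_cases hl (PT.const []) PT.snd'.snd).of_enc_eq fun a => by
    rcases l a with _ | ⟨b, t⟩ <;> rfl

theorem PT.headD {l : α → List β} {d : α → β} (hl : PT l) (hd : PT d) :
    PT fun a => (l a).headD (d a) :=
  (PT.list_cases hl hd PT.snd'.fst).of_enc_eq fun a => by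
    rcases l a with _ | ⟨b, t⟩ <;> rfl

theorem PT.isEmpty {l : α → List β} (hl : PT l) : PT fun a => (l a).isEmpty :=
  (PT.list_cases hl (PT.const true) (PT.const false)).of_enc_eq fun a => by
    rcases l a with _ | ⟨b, t⟩ <;> rfl

theorem PT.cons {f : α → β} {l : α → List β} (hf : PT f) (hl : PT l) : PT fun a => f a :: l a :=
  (hf.pair hl).of_enc_eq fun _ => rfl

theorem PT.bool_cases {b : α → Bool} {f : Bool → α → β} (hb : PT b) (ht : PT (f true))
    (hf : PT (f false)) : PT fun a => f (b a) a := by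
  have h1 : PT fun a => if b a then [()] else [] := hb.of_enc_eq fun a => by cases b a <;> rfl
  refine (PT.list_cases (g := fun a _ _ => f true a) h1 hf (ht.comp PT.fst')).of_enc_eq fun a => ?_
  cases b a <;> rfl

/-! ### Predicates -/

/-- The predicate `P` is decided by a stack program in polynomial time. -/
def PTP (P : α → Prop) : Prop := ∃ f : α → Bool, PT f ∧ ∀ a, f a = true ↔ P a

theorem PTP.of_iff {P Q : α → Prop} (h : PTP P) (e : ∀ a, Q a ↔ P a) : PTP Q :=
  let ⟨f, hf, h⟩ := h
  ⟨f, hf, fun a => (h a).trans (e a).symm⟩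

theorem PTP.comp {P : β → Prop} {f : α → β} (h : PTP P) (hf : PT f) : PTP fun a => P (f a) :=
  let ⟨p, hp, h⟩ := h
  ⟨fun a => p (f a), hp.comp hf, fun a => h (f a)⟩

theorem PTP.const (p : Prop) : PTP fun _ : α => p := by
  classical
  exact ⟨fun _ => decide p, PT.const _, fun _ => by simp⟩

theorem PTP.of_bool {f : α → Bool} (hf : PT f) : PTP fun a => f a = true := ⟨f, hf, fun _ => Iff.rfl⟩

theorem PTP.and {P Q : α → Prop} (hP : PTP P) (hQ : PTP Q) : PTP fun a => P a ∧ Q a := by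
  obtain ⟨p, hp, h⟩ := hP
  obtain ⟨q, hq, h'⟩ := hQ
  refine ⟨fun a => p a && q a, PT.bool_cases (f := fun b a => b && q a) hp ?_ ?_, fun a => ?_⟩
  · simpa using hq
  · simpa using PT.const false
  · rw [Bool.and_eq_true, h, h']

theorem PTP.not {P : α → Prop} (hP : PTP P) : PTP fun a => ¬ P a := by
  obtain ⟨p, hp, h⟩ := hP
  refine ⟨fun a => !p a, PT.bool_cases (f := fun b _ => !b) hp (PT.const _) (PT.const _),
    fun a => ?_⟩
  dsimp only
  rw [Bool.not_eq_true', ← h, Bool.not_eq_true]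

theorem PTP.or {P Q : α → Prop} (hP : PTP P) (hQ : PTP Q) : PTP fun a => P a ∨ Q a :=
  (hP.not.and hQ.not).not.of_iff fun a => by tauto

theorem PTP.imp {P Q : α → Prop} (hP : PTP P) (hQ : PTP Q) : PTP fun a => P a → Q a :=
  (hP.not.or hQ).of_iff fun a => by tauto

theorem PTP.iff {P Q : α → Prop} (hP : PTP P) (hQ : PTP Q) : PTP fun a => (P a ↔ Q a) :=
  ((hP.imp hQ).and (hQ.imp hP)).of_iff fun a => by tauto

theorem PT.ite {P : α → Prop} [∀ a, Decidable (P a)] {f g : α → β} (hP : PTP P) (hf : PT f)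
    (hg : PT g) : PT fun a => if P a then f a else g a := by
  obtain ⟨p, hp, h⟩ := hP
  refine (PT.bool_cases (f := fun b a => bif b then f a else g a) hp hf hg).of_enc_eq fun a => ?_
  have := h a
  by_cases hPa : P a
  · rw [if_pos hPa, this.2 hPa, cond_true]
  · rw [if_neg hPa, Bool.eq_false_iff.2 (mt this.1 hPa), cond_false]

theorem PTP.forall_finset {ι : Type} (s : Finset ι) {P : ι → α → Prop} (h : ∀ i, PTP (P i)) :
    PTP fun a => ∀ i ∈ s, P i a := by
  classical
  induction s using Finset.induction with
  | empty => simpa using PTP.const True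
  | insert i s _ ih => simpa using (h i).and ih

theorem PTP.forall {ι : Type} [Finite ι] {P : ι → α → Prop} (h : ∀ i, PTP (P i)) :
    PTP fun a => ∀ i, P i a := by
  have := Fintype.ofFinite ι
  simpa using PTP.forall_finset Finset.univ h

theorem PTP.exists {ι : Type} [Finite ι] {P : ι → α → Prop} (h : ∀ i, PTP (P i)) :
    PTP fun a => ∃ i, P i a :=
  (PTP.forall fun i => (h i).not).not.of_iff fun a => by push Not; rfl

/-! ### Lists -/

/-- Recursion along a list, if every step adds a polynomially bounded amount. -/
theorem PT.foldl_add {l : α → List β} {s₀ : α → σ} {h : α → σ → β → σ} (hl : PT l) (hs₀ : PT s₀)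
    (hh : PT fun x : α × σ × β => h x.1 x.2.1 x.2.2)
    (hb : ∃ K : α → ℕ, PB K ∧ ∀ a s, ∀ b ∈ l a, sz (h a s b) ≤ sz s + K a) :
    PT fun a => (l a).foldl (h a) (s₀ a) := by
  obtain ⟨K, hK, hb⟩ := hb
  refine PT.foldl hl hs₀ hh ⟨fun a => sz (s₀ a) + sz (l a) * K a,
    hs₀.pb.add (hl.pb.mul hK), fun a l₁ l₂ e => ?_⟩
  have key : ∀ (t : List β) (s : σ), (∀ b ∈ t, b ∈ l a) →
      sz (t.foldl (h a) s) ≤ sz s + t.length * K a := by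
    intro t
    induction t with
    | nil => intro s _; simp
    | cons b t ih =>
      intro s ht
      have h1 := ih (h a s b) fun b' hb' => ht b' (List.mem_cons_of_mem _ hb')
      have h2 := hb a s b (ht b List.mem_cons_self)
      rw [List.foldl_cons, List.length_cons, Nat.succ_mul]
      omega
  have h1 := key l₁ (s₀ a) fun b hb' => by rw [e]; exact List.mem_append_left _ hb'
  have h2 : l₁.length ≤ sz (l a) := by
    have := length_lt_sz (l a)
    rw [e, List.length_append] at this
    rw [e]
    omega
  exact h1.trans (Nat.add_le_add_left (Nat.mul_le_mul_right _ h2) _)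

theorem PB.mem {l : α → List β} {m : α × β → ℕ} (hm : PB m) (hl : PT l) :
    ∃ K : α → ℕ, PB K ∧ ∀ a, ∀ b ∈ l a, m (a, b) ≤ K a := by
  obtain ⟨p, hp⟩ := hm
  refine ⟨fun a => p.eval (1 + IOGadget.sz a + IOGadget.sz (l a)),
    (((PB.const 1).add PB.sz).add hl.pb).eval p, fun a b hb => ?_⟩
  refine (hp (a, b)).trans (polynomial_eval_mono p ?_)
  have := sz_mem_lt hb
  simp only [sz_prod]
  omega

theorem PT.reverse {l : α → List β} (hl : PT l) : PT fun a => (l a).reverse := by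
  refine (PT.foldl_add (h := fun _ s b => b :: s) hl (PT.const []) (PT.snd'.snd.cons PT.snd'.fst)
    ⟨fun a => sz (l a), hl.pb, fun a s b hb => ?_⟩).of_enc_eq fun a => by simp
  have := sz_mem_lt hb
  simp only [sz_cons]
  omega

theorem PT.append {l l' : α → List β} (hl : PT l) (hl' : PT l') : PT fun a => l a ++ l' a := by
  refine (PT.foldl_add (h := fun _ s b => b :: s) hl.reverse hl' (PT.snd'.snd.cons PT.snd'.fst)
    ⟨fun a => sz (l a), hl.pb, fun a s b hb => ?_⟩).of_enc_eq fun a => by simp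
  have := sz_mem_lt (List.mem_reverse.1 hb)
  simp only [sz_cons]
  omega

theorem PT.flatMap {l : α → List β} {h : α → β → List γ} (hl : PT l)
    (hh : PT fun x : α × β => h x.1 x.2) : PT fun a => (l a).flatMap (h a) := by
  obtain ⟨K, hK, hb⟩ := PB.mem hh.pb hl
  refine (PT.foldl_add (h := fun a s b => s ++ h a b) hl (PT.const [])
    (PT.snd'.fst.append (hh.comp (PT.fst'.pair PT.snd'.snd)))
    ⟨K, hK, fun a s b hb' => ?_⟩).of_enc_eq fun a => ?_
  · have := sz_append s (h a b)
    have := hb a b hb'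
    dsimp only at this
    omega
  · have : ∀ (t : List β) s, t.foldl (fun s b => s ++ h a b) s = s ++ t.flatMap (h a) := by
      intro t
      induction t with
      | nil => simp
      | cons b t ih => intro s; rw [List.foldl_cons, ih]; simp
    rw [this, List.nil_append]

theorem PT.map {l : α → List β} {h : α → β → γ} (hl : PT l)
    (hh : PT fun x : α × β => h x.1 x.2) : PT fun a => (l a).map (h a) :=
  (PT.flatMap (h := fun a b => [h a b]) hl (hh.cons (PT.const []))).of_enc_eq fun a => by
    rw [List.map_eq_flatMap]

theorem PTP.forall_mem {l : α → List β} {P : α → β → Prop} (hl : PT l)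
    (hP : PTP fun x : α × β => P x.1 x.2) : PTP fun a => ∀ b ∈ l a, P a b := by
  obtain ⟨p, hp, h⟩ := hP
  refine ⟨fun a => (l a).foldl (fun s b => s && p (a, b)) true,
    PT.foldl_add (h := fun a s b => s && p (a, b)) hl (PT.const true) ?_ ⟨fun _ => 3, PB.const 3,
      fun a s b _ => (sz_bool_le _).trans (Nat.le_add_left _ _)⟩, fun a => ?_⟩
  · refine PT.bool_cases (f := fun b (x : α × Bool × β) => b && p (x.1, x.2.2)) PT.snd'.fst ?_ ?_
    · simpa using hp.comp (PT.fst'.pair PT.snd'.snd)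
    · simpa using PT.const false
  · have : ∀ (t : List β) s, t.foldl (fun s b => s && p (a, b)) s = true ↔
        s = true ∧ ∀ b ∈ t, P a b := by
      intro t
      induction t with
      | nil => simp
      | cons b t ih =>
        intro s
        rw [List.foldl_cons, ih, Bool.and_eq_true, h]
        simp [and_assoc]
    rw [this]
    simp

theorem PTP.exists_mem {l : α → List β} {P : α → β → Prop} (hl : PT l)
    (hP : PTP fun x : α × β => P x.1 x.2) : PTP fun a => ∃ b ∈ l a, P a b :=
  (PTP.forall_mem (P := fun a b => ¬ P a b) hl hP.not).not.of_iff fun a => by push Not; rfl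

/-! ### Equality -/

/-- Types whose equality is decided in polynomial time. -/
class PTEq (β : Type) [TEnc β] : Prop where
  eq' : PTP fun x : β × β => x.1 = x.2

theorem PTP.eq [PTEq β] {f g : α → β} (hf : PT f) (hg : PT g) : PTP fun a => f a = g a :=
  PTEq.eq'.comp (hf.pair hg)

theorem PTP.isEmpty {l : α → List β} (hl : PT l) : PTP fun a => l a = [] :=
  (PTP.of_bool hl.isEmpty).of_iff fun a => by simp

instance : PTEq Bool := by
  refine ⟨fun x => x.1 == x.2, PT.bool_cases (f := fun b (x : Bool × Bool) => b == x.2) PT.fst'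
    ?_ ?_, fun a => by simp⟩
  · exact PT.bool_cases (f := fun b _ => true == b) PT.snd' (PT.const _) (PT.const _)
  · exact PT.bool_cases (f := fun b _ => false == b) PT.snd' (PT.const _) (PT.const _)

instance [PTEq β] [PTEq γ] : PTEq (β × γ) :=
  ⟨((PTP.eq PT.fst'.fst PT.snd'.fst).and (PTP.eq PT.fst'.snd PT.snd'.snd)).of_iff
    fun _ => Prod.ext_iff⟩

theorem sz_tail_le (l : List β) : sz l.tail ≤ sz l := by
  cases l <;> simp

instance [PTEq β] : PTEq (List β) := by
  obtain ⟨p, hp, h⟩ := PTEq.eq' (β := β)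
  let step : List β × Bool → β → List β × Bool := fun s b =>
    (s.1.tail, s.2 && (!s.1.isEmpty && p (b, s.1.headD b)))
  have hstep : PT fun x : (List β × List β) × (List β × Bool) × β => step x.2.1 x.2.2 := by
    refine PT.snd'.fst.fst.tail.pair ?_
    refine PT.bool_cases (f := fun c (x : (List β × List β) × (List β × Bool) × β) =>
      c && (!x.2.1.1.isEmpty && p (x.2.2, x.2.1.1.headD x.2.2))) PT.snd'.fst.snd ?_ ?_
    · refine PT.bool_cases (f := fun c (x : (List β × List β) × (List β × Bool) × β) =>
        true && (!c && p (x.2.2, x.2.1.1.headD x.2.2))) PT.snd'.fst.fst.isEmpty ?_ ?_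
      · simpa using PT.const false
      · simpa using hp.comp (PT.snd'.snd.pair (PT.headD PT.snd'.fst.fst PT.snd'.snd))
    · simpa using PT.const false
  have hfold : PT fun x : List β × List β => x.1.foldl step (x.2, true) := by
    refine PT.foldl_add (h := fun _ => step) PT.fst' (PT.snd'.pair (PT.const true)) hstep
      ⟨fun _ => 3, PB.const 3, fun a s b _ => ?_⟩
    have h1 := sz_tail_le s.1
    have h2 := sz_bool_le (s.2 && (!s.1.isEmpty && p (b, s.1.headD b)))
    simp only [step, sz_prod]
    omega
  have key : ∀ (l l' : List β) (c : Bool),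
      ((l.foldl step (l', c)).2 = true ∧ (l.foldl step (l', c)).1 = []) ↔ (c = true ∧ l = l') := by
    intro l
    induction l with
    | nil => intro l' c; simp [eq_comm]
    | cons b l ih =>
      intro l' c
      rw [List.foldl_cons, ih]
      rcases l' with _ | ⟨b', l'⟩
      · simp
      · have := h (b, b')
        simp only at this
        simp [this, and_assoc]
  exact ⟨((PTP.of_bool hfold.snd).and (PTP.isEmpty hfold.fst)).of_iff fun x => by
    rw [key]; simp⟩

/-! ### Natural numbers -/

instance : TEnc ℕ := ⟨fun n => enc n.bits⟩

theorem PT.bits {f : α → ℕ} (hf : PT f) : PT fun a => (f a).bits := hf.of_enc_eq fun _ => rfl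

theorem sz_nat (n : ℕ) : sz n = sz n.bits := rfl

theorem sz_zero : sz 0 = 1 := by rw [sz_nat, Nat.zero_bits, sz_nil]

theorem sz_nat_le (n : ℕ) : sz n ≤ 1 + 4 * n.size := by
  have := sz_le_of_forall (l := n.bits) le_rfl (m := 3) fun b _ => sz_bool_le b
  rw [← Nat.size_eq_bits_len, sz_nat]
  omega

theorem size_lt_sz (n : ℕ) : n.size < sz n := by
  rw [← Nat.size_eq_bits_len, sz_nat]
  exact length_lt_sz _

theorem size_le_self (n : ℕ) : n.size ≤ n := Nat.size_le.2 n.lt_two_pow_self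

theorem size_add_le (m n : ℕ) : (m + n).size ≤ m.size + n.size + 1 := by
  rw [Nat.size_le, pow_succ]
  have h1 : m < 2 ^ (m.size + n.size) := (Nat.lt_size_self m).trans_le
    (Nat.pow_le_pow_right (by norm_num) (by omega))
  have h2 : n < 2 ^ (m.size + n.size) := (Nat.lt_size_self n).trans_le
    (Nat.pow_le_pow_right (by norm_num) (by omega))
  omega

theorem bits_foldr (n : ℕ) : n.bits.foldr Nat.bit 0 = n := by
  induction n using Nat.binaryRec' with
  | zero => simp
  | bit b n hn ih => rw [Nat.bits_append_bit n b hn, List.foldr_cons, ih]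

instance : PTEq ℕ :=
  ⟨(PTP.eq PT.fst'.bits PT.snd'.bits).of_iff fun x =>
    ⟨fun h => by rw [h], fun h => by rw [← bits_foldr x.1, h, bits_foldr]⟩⟩

theorem bits_bit (b : Bool) (n : ℕ) :
    (Nat.bit b n).bits = if b = false ∧ n.bits = [] then [] else b :: n.bits := by
  by_cases hn : n = 0 → b = true
  · rw [Nat.bits_append_bit n b hn, if_neg]
    rintro ⟨h, h'⟩
    have : n = 0 := by rw [← bits_foldr n, h']; rfl
    simp [hn this] at h
  · push Not at hn
    obtain ⟨rfl, hb⟩ := hn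
    simp at hb
    simp [hb]

theorem PT.bit {b : α → Bool} {f : α → ℕ} (hb : PT b) (hf : PT f) :
    PT fun a => Nat.bit (b a) (f a) := by
  have h : PT fun a => if b a = false ∧ (f a).bits = [] then [] else b a :: (f a).bits :=
    PT.ite ((PTP.eq hb (PT.const _)).and (PTP.isEmpty hf.bits)) (PT.const _) (hb.cons hf.bits)
  exact h.of_enc_eq fun a => congrArg enc (bits_bit _ _)

theorem sz_bit_le (b : Bool) (n : ℕ) : sz (Nat.bit b n) ≤ sz n + 4 := by
  rw [sz_nat, bits_bit, sz_nat]
  have := sz_bool_le b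
  have := one_le_sz n.bits
  split_ifs
  · simp only [sz_nil]; omega
  · simp only [sz_cons]; omega

theorem PT.bodd {f : α → ℕ} (hf : PT f) : PT fun a => (f a).bodd :=
  (hf.bits.headD (PT.const false)).of_enc_eq fun a => by
    rw [Nat.bodd_eq_bits_head]
    cases (f a).bits <;> rfl

theorem PT.div2 {f : α → ℕ} (hf : PT f) : PT fun a => (f a).div2 :=
  hf.bits.tail.of_enc_eq fun _ => congrArg enc (Nat.div2_bits_eq_tail _)

theorem sz_div2_le (n : ℕ) : sz n.div2 ≤ sz n := by
  rw [sz_nat, Nat.div2_bits_eq_tail]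
  exact sz_tail_le _

/-- The number with given binary digits, the most significant digit first. -/
def ofDigits (l : List Bool) : ℕ := l.foldl (fun n b => Nat.bit b n) 0

theorem PT.ofDigits {l : α → List Bool} (hl : PT l) : PT fun a => ofDigits (l a) :=
  PT.foldl_add (h := fun _ n b => Nat.bit b n) hl (PT.const 0) (PT.bit PT.snd'.snd PT.snd'.fst)
    ⟨fun _ => 4, PB.const 4, fun _ _ _ _ => sz_bit_le _ _⟩

/-- One step of the addition of binary numbers: the two summands, the carry, and the digits of the
result, the most significant digit first. -/
def addStep (s : (ℕ × ℕ) × Bool × List Bool) : (ℕ × ℕ) × Bool × List Bool :=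
  ((s.1.1.div2, s.1.2.div2), Bool.atLeastTwo s.1.1.bodd s.1.2.bodd s.2.1,
    (s.1.1.bodd ^^ s.1.2.bodd ^^ s.2.1) :: s.2.2)

theorem ofDigits_foldl (l : List Bool) :
    ∀ n, l.foldl (fun n b => Nat.bit b n) n = 2 ^ l.length * n + ofDigits l := by
  induction l with
  | nil => intro n; simp [ofDigits]
  | cons b l ih =>
    intro n
    unfold ofDigits
    simp only [List.foldl_cons]
    rw [ih, ih (Nat.bit b 0)]
    simp only [List.length_cons, Nat.bit_val, pow_succ]
    ring

theorem ofDigits_cons (b : Bool) (l : List Bool) :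
    ofDigits (b :: l) = 2 ^ l.length * b.toNat + ofDigits l := by
  unfold ofDigits
  rw [List.foldl_cons, ofDigits_foldl]
  simp [Nat.bit_val, ofDigits]

theorem addStep_iterate (m n i : ℕ) :
    (addStep^[i] ((m, n), false, [])).2.2.length = i ∧
    ((addStep^[i] ((m, n), false, [])).1.1 + (addStep^[i] ((m, n), false, [])).1.2 +
      (addStep^[i] ((m, n), false, [])).2.1.toNat) * 2 ^ i +
      ofDigits (addStep^[i] ((m, n), false, [])).2.2 = m + n := by
  induction i with
  | zero => simp [ofDigits]
  | succ i ih =>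
    rw [Function.iterate_succ_apply']
    generalize addStep^[i] ((m, n), false, []) = s at ih ⊢
    obtain ⟨⟨x, y⟩, c, l⟩ := s
    dsimp only at ih
    obtain ⟨h1, h2⟩ := ih
    refine ⟨by simp [addStep, h1], ?_⟩
    rw [← h2]
    simp only [addStep, ofDigits_cons, h1, pow_succ]
    have hx := Nat.bodd_add_div2 x
    have hy := Nat.bodd_add_div2 y
    have : (x.div2 + y.div2 + (Bool.atLeastTwo x.bodd y.bodd c).toNat) * 2 +
        (x.bodd ^^ y.bodd ^^ c).toNat = x + y + c.toNat := by
      conv_rhs => rw [← hx, ← hy]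
      cases x.bodd <;> cases y.bodd <;> cases c <;> simp [Bool.atLeastTwo] <;> omega
    rw [← this]
    ring

theorem foldl_const {σ ι : Type} (f : σ → σ) (l : List ι) :
    ∀ s, l.foldl (fun s _ => f s) s = f^[l.length] s := by
  induction l with
  | nil => intro s; rfl
  | cons b l ih => intro s; rw [List.foldl_cons, ih]; rfl

theorem PT.add {f g : α → ℕ} (hf : PT f) (hg : PT g) : PT fun a => f a + g a := by
  have hstep : PT addStep := by
    have h1 : PT fun s : (ℕ × ℕ) × Bool × List Bool => s.1.1 := PT.fst'.fst
    have h2 : PT fun s : (ℕ × ℕ) × Bool × List Bool => s.1.2 := PT.fst'.snd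
    have h3 : PT fun s : (ℕ × ℕ) × Bool × List Bool => s.2.1 := PT.snd'.fst
    have hF : ∀ F : Bool → Bool → Bool → Bool,
        PT fun s : (ℕ × ℕ) × Bool × List Bool => F s.1.1.bodd s.1.2.bodd s.2.1 := by
      intro F
      refine PT.bool_cases (f := fun b (s : (ℕ × ℕ) × Bool × List Bool) => F b s.1.2.bodd s.2.1)
        h1.bodd ?_ ?_
      all_goals
        refine PT.bool_cases (f := fun b (s : (ℕ × ℕ) × Bool × List Bool) => F _ b s.2.1)
          h2.bodd ?_ ?_
        all_goals
          exact PT.bool_cases (f := fun b (s : (ℕ × ℕ) × Bool × List Bool) => F _ _ b)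
            h3 (PT.const _) (PT.const _)
    exact (h1.div2.pair h2.div2).pair ((hF Bool.atLeastTwo).pair
      ((hF fun x y c => x ^^ y ^^ c).cons PT.snd'.snd))
  have hfold : PT fun a => ((f a).bits ++ (g a).bits ++ [true]).foldl (fun s _ => addStep s)
      ((f a, g a), false, []) := by
    refine PT.foldl_add (h := fun _ s _ => addStep s) ((hf.bits.append hg.bits).append (PT.const _))
      ((hf.pair hg).pair (PT.const _)) (hstep.comp PT.snd'.fst)
      ⟨fun _ => 7, PB.const 7, fun _ s b _ => ?_⟩
    have h1 := sz_div2_le s.1.1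
    have h2 := sz_div2_le s.1.2
    have h3 := sz_bool_le (Bool.atLeastTwo s.1.1.bodd s.1.2.bodd s.2.1)
    have h4 := sz_bool_le (s.1.1.bodd ^^ s.1.2.bodd ^^ s.2.1)
    simp only [addStep, sz_prod, sz_cons]
    omega
  refine hfold.snd.snd.ofDigits.of_enc_eq fun a => congrArg enc ?_
  rw [foldl_const]
  simp only [List.length_append, Nat.size_eq_bits_len, List.length_singleton]
  have h1 := (addStep_iterate (f a) (g a) ((f a).size + (g a).size + 1)).2
  have h2 := (Nat.lt_size_self (f a + g a)).trans_le (Nat.pow_le_pow_right (by norm_num : 0 < 2)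
    (size_add_le (f a) (g a)))
  set s := addStep^[(f a).size + (g a).size + 1] ((f a, g a), false, [])
  rcases Nat.eq_zero_or_pos (s.1.1 + s.1.2 + s.2.1.toNat) with h3 | h3
  · rw [h3] at h1; omega
  · have := Nat.mul_le_mul_right (2 ^ ((f a).size + (g a).size + 1)) h3
    omega

theorem PT.const_mul (k : ℕ) {f : α → ℕ} (hf : PT f) : PT fun a => k * f a := by
  induction k with
  | zero => simpa using PT.const 0
  | succ k ih => simpa [Nat.succ_mul] using ih.add hf

theorem size_sum_le (l : List ℕ) : l.sum.size ≤ sz l := by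
  induction l with
  | nil => simp
  | cons n l ih =>
    have h1 := size_add_le n l.sum
    have h2 := size_lt_sz n
    rw [List.sum_cons, sz_cons]
    omega

theorem PT.sum {l : α → List ℕ} (hl : PT l) : PT fun a => (l a).sum := by
  refine (PT.foldl (h := fun _ m n => m + n) hl (PT.const 0) (PT.snd'.fst.add PT.snd'.snd)
    ⟨fun a => 1 + 4 * sz (l a), (PB.const 1).add ((PB.const 4).mul hl.pb),
      fun a l₁ l₂ e => ?_⟩).of_enc_eq fun a => by rw [List.sum_eq_foldl]
  rw [← List.sum_eq_foldl]
  have h1 := sz_nat_le l₁.sum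
  have h2 := size_sum_le l₁
  have h3 := sz_append l₁ l₂
  have h4 := one_le_sz l₂
  rw [← e] at h3
  dsimp only
  omega

theorem PT.finset_sum {ι : Type} (s : Finset ι) {f : ι → α → ℕ} (h : ∀ i, PT (f i)) :
    PT fun a => ∑ i ∈ s, f i a := by
  classical
  induction s using Finset.induction with
  | empty => simpa using PT.const 0
  | insert i s hi ih => simpa [Finset.sum_insert hi] using (h i).add ih

theorem sz_nat_le_of_le {m n : ℕ} (h : m ≤ n) : sz m ≤ 1 + 4 * n := by
  have := sz_nat_le m
  have := size_le_self m
  omega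

theorem add_one_iterate (i n : ℕ) : (fun m => m + 1)^[i] n = n + i := by
  induction i with
  | zero => rfl
  | succ i ih => rw [Function.iterate_succ_apply', ih]; rfl

theorem PT.length {l : α → List β} (hl : PT l) : PT fun a => (l a).length := by
  refine (PT.foldl (h := fun _ m _ => m + 1) hl (PT.const 0) (PT.snd'.fst.add (PT.const 1))
    ⟨fun a => 1 + 4 * sz (l a), (PB.const 1).add ((PB.const 4).mul hl.pb),
      fun a l₁ l₂ e => ?_⟩).of_enc_eq fun a => ?_
  · rw [foldl_const (fun m => m + 1), add_one_iterate]
    have h1 := length_lt_sz (l a)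
    rw [e, List.length_append, ← e] at h1
    exact sz_nat_le_of_le (by omega)
  · rw [foldl_const (fun m => m + 1), add_one_iterate, zero_add]

/-- Drop a number of elements that is given in binary. -/
theorem PT.drop {l : α → List β} {n : α → ℕ} (hl : PT l) (hn : PT n) :
    PT fun a => (l a).drop (n a) := by
  have key : ∀ a i, (fun s : List β × ℕ => if s.2 = n a then s else (s.1.tail, s.2 + 1))^[i]
      (l a, 0) = ((l a).drop (min i (n a)), min i (n a)) := by
    intro a i
    induction i with
    | zero => simp
    | succ i ih =>
      rw [Function.iterate_succ_apply', ih]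
      by_cases h : n a ≤ i
      · rw [if_pos (by simpa using h), min_eq_right h, min_eq_right (by omega)]
      · rw [if_neg (by simp; omega), min_eq_left (by omega), min_eq_left (by omega)]
        simp
  have h : PT fun a => (l a).foldl (fun (s : List β × ℕ) _ =>
      if s.2 = n a then s else (s.1.tail, s.2 + 1)) (l a, 0) := by
    refine PT.foldl (h := fun a (s : List β × ℕ) _ =>
      if s.2 = n a then s else (s.1.tail, s.2 + 1)) hl (hl.pair (PT.const 0)) ?_
      ⟨fun a => 1 + sz (l a) + (1 + 4 * sz (l a)), ?_, fun a l₁ l₂ e => ?_⟩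
    · exact PT.ite (PTP.eq PT.snd'.fst.snd (hn.comp PT.fst')) PT.snd'.fst
        (PT.snd'.fst.fst.tail.pair (PT.snd'.fst.snd.add (PT.const 1)))
    · exact ((PB.const 1).add hl.pb).add ((PB.const 1).add ((PB.const 4).mul hl.pb))
    · rw [foldl_const (fun s : List β × ℕ => if s.2 = n a then s else (s.1.tail, s.2 + 1)), key]
      have h1 := length_lt_sz (l a)
      have h2 : l₁.length ≤ (l a).length := by rw [e, List.length_append]; omega
      have h3 := sz_append ((l a).take (min l₁.length (n a))) ((l a).drop (min l₁.length (n a)))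
      rw [List.take_append_drop] at h3
      have h4 := one_le_sz ((l a).take (min l₁.length (n a)))
      have h5 := sz_nat_le_of_le (show min l₁.length (n a) ≤ sz (l a) by omega)
      simp only [sz_prod]
      omega
  refine h.fst.of_enc_eq fun a => ?_
  rw [foldl_const (fun s : List β × ℕ => if s.2 = n a then s else (s.1.tail, s.2 + 1)), key]
  congr 1
  rcases le_total (l a).length (n a) with h | h
  · rw [min_eq_left h, List.drop_length, List.drop_eq_nil_of_le h]
  · rw [min_eq_right h]

theorem PT.getD {l : α → List β} {n : α → ℕ} {d : α → β} (hl : PT l) (hn : PT n) (hd : PT d) :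
    PT fun a => (l a).getD (n a) (d a) :=
  ((hl.drop hn).headD hd).of_enc_eq fun a => by
    rw [List.headD_eq_head?_getD, List.head?_drop, List.getD_eq_getElem?_getD]

/-- The numbers below a number that is given in binary, up to the length of a list. -/
theorem PT.range_min {l : α → List β} {n : α → ℕ} (hl : PT l) (hn : PT n) :
    PT fun a => List.range (min (l a).length (n a)) := by
  have key : ∀ a i, (fun s : List ℕ => if s.length = n a then s else s ++ [s.length])^[i] [] =
      List.range (min i (n a)) := by
    intro a i
    induction i with
    | zero => simp
    | succ i ih =>
      rw [Function.iterate_succ_apply', ih]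
      by_cases h : n a ≤ i
      · rw [if_pos (by simpa using h), min_eq_right h, min_eq_right (by omega)]
      · rw [if_neg (by simp; omega), min_eq_left (by omega), min_eq_left (by omega)]
        simp [List.range_succ]
  refine (PT.foldl (h := fun a (s : List ℕ) _ => if s.length = n a then s else s ++ [s.length])
    hl (PT.const []) ?_ ⟨fun a => 1 + sz (l a) * (1 + (1 + 4 * sz (l a))), ?_,
      fun a l₁ l₂ e => ?_⟩).of_enc_eq fun a => ?_
  · exact PT.ite (PTP.eq PT.snd'.fst.length (hn.comp PT.fst')) PT.snd'.fst
      (PT.snd'.fst.append (PT.snd'.fst.length.cons (PT.const [])))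
  · exact (PB.const 1).add (hl.pb.mul ((PB.const 1).add ((PB.const 1).add
      ((PB.const 4).mul hl.pb))))
  · rw [foldl_const (fun s : List ℕ => if s.length = n a then s else s ++ [s.length]), key]
    have h1 := length_lt_sz (l a)
    have h2 : l₁.length ≤ (l a).length := by rw [e, List.length_append]; omega
    refine sz_le_of_forall (by rw [List.length_range]; omega) fun i hi => ?_
    rw [List.mem_range] at hi
    exact sz_nat_le_of_le (by omega)
  · rw [foldl_const (fun s : List ℕ => if s.length = n a then s else s ++ [s.length]), key]

/-! ### Finite types -/

theorem PT.of_finite {A : Type} [Finite A] [TEnc A] (e : A → ℕ) (he : Function.Injective e)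
    (henc : ∀ a : A, enc a = enc (e a)) (f : A → β) : PT f := by
  classical
  have := Fintype.ofFinite A
  have hPe : PT e := PT.id.of_enc_eq fun a => (henc a).symm
  rcases isEmpty_or_nonempty A with h | ⟨⟨a₀⟩⟩
  · exact ⟨⟨0, fun a => h.elim a⟩, .skip, fun _ => 0, PB.const 0, fun a => h.elim a⟩
  have key : ∀ s : Finset A, ∃ g : A → β, PT g ∧ ∀ a ∈ s, g a = f a := by
    intro s
    induction s using Finset.induction with
    | empty => exact ⟨fun _ => f a₀, PT.const _, by simp⟩
    | insert a s _ ih =>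
      obtain ⟨g, hg, h⟩ := ih
      refine ⟨fun x => if e x = e a then f a else g x,
        PT.ite (PTP.eq hPe (PT.const _)) (PT.const _) hg, fun x hx => ?_⟩
      by_cases hxa : x = a
      · simp [hxa]
      · dsimp only
        rw [if_neg (fun h => hxa (he h)), h x ((Finset.mem_insert.1 hx).resolve_left hxa)]
  obtain ⟨g, hg, h⟩ := key Finset.univ
  rwa [show f = g from funext fun a => (h a (Finset.mem_univ _)).symm]

end

/-! ### Legal sequences and Eulerian trails -/

namespace Gadget

variable (G : Gadget)

/-- Starting in state `s`, the gadget can perform the given transitions one after the other and is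
in state `e` after them. -/
def Trail : Fin G.numStates → List (Fin G.numTrans) → Fin G.numStates → Prop
  | s, [], e => s = e
  | s, t :: ts, e => (G.src t).1 = s ∧ Trail (G.dst t).1 ts e

variable {G}

theorem isLegal_iff {ts : List (Fin G.numTrans)} :
    ∀ {s}, G.IsLegal s ts ↔ ∃ e, G.Trail s ts e := by
  induction ts with
  | nil => intro s; simp [IsLegal, Trail]
  | cons t ts ih => intro s; simp [IsLegal, Trail, ih]

theorem trail_append {a b : List (Fin G.numTrans)} {e} :
    ∀ {s}, G.Trail s (a ++ b) e ↔ ∃ m, G.Trail s a m ∧ G.Trail m b e := by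
  induction a with
  | nil => intro s; simp [Trail]
  | cons t a ih => intro s; simp [Trail, ih, and_assoc]

variable (G)

/-- The number of uses of transitions that leave the state `q`. -/
def outSum (f : Fin G.numTrans → ℕ) (q : Fin G.numStates) : ℕ :=
  ∑ t ∈ Finset.univ.filter (fun t => (G.src t).1 = q), f t

/-- The number of uses of transitions that lead to the state `q`. -/
def inSum (f : Fin G.numTrans → ℕ) (q : Fin G.numStates) : ℕ :=
  ∑ t ∈ Finset.univ.filter (fun t => (G.dst t).1 = q), f t

/-- The numbers of uses `f` are balanced, up to one unit from `s` to `e`. -/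
def Balanced (f : Fin G.numTrans → ℕ) (s e : Fin G.numStates) : Prop :=
  ∀ q, G.outSum f q + (if q = e then 1 else 0) = G.inSum f q + (if q = s then 1 else 0)

/-- There is a transition in `U` from one state to the other. -/
def StepIn (U : Set (Fin G.numTrans)) (a b : Fin G.numStates) : Prop :=
  ∃ t ∈ U, (G.src t).1 = a ∧ (G.dst t).1 = b

variable {G}

theorem outSum_cons (t : Fin G.numTrans) (ts : List (Fin G.numTrans)) (q : Fin G.numStates) :
    G.outSum (fun u => (t :: ts).count u) q =
      G.outSum (fun u => ts.count u) q + if (G.src t).1 = q then 1 else 0 := by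
  simp [outSum, List.count_cons, Finset.sum_add_distrib, Finset.sum_filter]

theorem inSum_cons (t : Fin G.numTrans) (ts : List (Fin G.numTrans)) (q : Fin G.numStates) :
    G.inSum (fun u => (t :: ts).count u) q =
      G.inSum (fun u => ts.count u) q + if (G.dst t).1 = q then 1 else 0 := by
  simp [inSum, List.count_cons, Finset.sum_add_distrib, Finset.sum_filter]

theorem Trail.balanced {ts : List (Fin G.numTrans)} {e} :
    ∀ {s}, G.Trail s ts e → G.Balanced (fun t => ts.count t) s e := by
  induction ts with
  | nil => rintro s rfl q; simp [outSum, inSum]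
  | cons t ts ih =>
    rintro s ⟨rfl, h⟩ q
    have := ih h q
    rw [outSum_cons, inSum_cons]
    simp only [eq_comm (a := q)] at this ⊢
    omega

theorem Trail.stepIn {ts : List (Fin G.numTrans)} {U : Set (Fin G.numTrans)} {e} :
    ∀ {s}, G.Trail s ts e → (∀ t ∈ ts, t ∈ U) → Relation.ReflTransGen (G.StepIn U) s e := by
  induction ts with
  | nil => rintro s rfl _; exact .refl
  | cons t ts ih =>
    rintro s ⟨rfl, h⟩ hU
    exact .head ⟨t, hU t List.mem_cons_self, rfl, rfl⟩
      (ih h fun u hu => hU u (List.mem_cons_of_mem _ hu))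

theorem length_le_of_count_le {ι : Type} [Fintype ι] [DecidableEq ι] {f : ι → ℕ} {l : List ι}
    (h : ∀ i, l.count i ≤ f i) : l.length ≤ ∑ i, f i := by
  rw [← List.sum_toFinset_count_eq_length]
  exact (Finset.sum_le_sum fun i _ => h i).trans
    (Finset.sum_le_sum_of_subset (Finset.subset_univ _))

theorem exists_longest {ι : Type} {p : List ι → Prop} {B : ℕ} (h : ∃ l, p l)
    (hB : ∀ l, p l → l.length ≤ B) : ∃ l, p l ∧ ∀ l', p l' → l'.length ≤ l.length := by
  by_contra! hc
  have : ∀ n, ∃ l, p l ∧ n ≤ l.length := by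
    intro n
    induction n with
    | zero => obtain ⟨l, hl⟩ := h; exact ⟨l, hl, Nat.zero_le _⟩
    | succ n ih =>
      obtain ⟨l, hl, hn⟩ := ih
      obtain ⟨l', hl', hn'⟩ := hc l hl
      exact ⟨l', hl', by omega⟩
  obtain ⟨l, hl, hn⟩ := this (B + 1)
  have := hB l hl
  omega

theorem exists_maximal_trail {r : Fin G.numTrans → ℕ} {v e : Fin G.numStates}
    (hr : G.Balanced r v e) : ∃ ts, G.Trail v ts e ∧ (∀ t, ts.count t ≤ r t) ∧
      ∀ t, (G.src t).1 = e → ts.count t = r t := by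
  obtain ⟨ts, ⟨⟨e', he'⟩, hc⟩, hmax⟩ := exists_longest
    (p := fun ts => (∃ e', G.Trail v ts e') ∧ ∀ t, ts.count t ≤ r t) (B := ∑ t, r t)
    ⟨[], ⟨v, rfl⟩, by simp⟩ fun l hl => length_le_of_count_le hl.2
  have hex : ∀ t, (G.src t).1 = e' → ts.count t = r t := by
    intro t ht
    by_contra hne
    have := hmax (ts ++ [t]) ⟨⟨(G.dst t).1, trail_append.2 ⟨e', he', ht, rfl⟩⟩, fun u => ?_⟩
    · simp at this
    · rw [List.count_append, List.count_singleton]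
      have h1 := hc u
      by_cases hut : t = u
      · subst hut
        simp
        omega
      · simpa [hut] using h1
  have hee : e' = e := by
    by_contra hne
    have h1 := he'.balanced e'
    have h2 := hr e'
    have h3 : G.outSum (fun t => ts.count t) e' = G.outSum r e' :=
      Finset.sum_congr rfl fun t ht => hex t (Finset.mem_filter.1 ht).2
    have h4 : G.inSum (fun t => ts.count t) e' ≤ G.inSum r e' :=
      Finset.sum_le_sum fun t _ => hc t
    rw [if_pos rfl] at h1
    rw [if_neg hne] at h2
    omega
  subst hee
  exact ⟨ts, he', hc, hex⟩

/-- The numbers of uses of the transitions by legal sequences are those which are balanced and whose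
support is connected to the initial state. -/
theorem exists_isLegal_count_iff (f : Fin G.numTrans → ℕ) (s : Fin G.numStates) :
    (∃ ts : List (Fin G.numTrans), G.IsLegal s ts ∧ ∀ t, ts.count t = f t) ↔
      (∃ e, G.Balanced f s e) ∧
        ∀ t, f t ≠ 0 → Relation.ReflTransGen (G.StepIn {t | f t ≠ 0}) s (G.src t).1 := by
  constructor
  · rintro ⟨ts, hts, hf⟩
    obtain ⟨e, he⟩ := isLegal_iff.1 hts
    obtain rfl : (fun t => ts.count t) = f := funext hf
    refine ⟨⟨e, he.balanced⟩, fun t ht => ?_⟩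
    obtain ⟨a, b, rfl⟩ := List.append_of_mem (List.count_pos_iff.1 (Nat.pos_of_ne_zero ht))
    obtain ⟨m, h1, rfl, -⟩ := trail_append.1 he
    refine h1.stepIn fun u hu => ?_
    have : 0 < (a ++ t :: b).count u := List.count_pos_iff.2 (List.mem_append_left _ hu)
    exact this.ne'
  · rintro ⟨⟨e, he⟩, hconn⟩
    obtain ⟨ts₀, h₀, hc₀, -⟩ := exists_maximal_trail he
    obtain ⟨ts, ⟨hts, hc⟩, hmax⟩ := exists_longest
      (p := fun ts => G.Trail s ts e ∧ ∀ t, ts.count t ≤ f t) (B := ∑ t, f t)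
      ⟨ts₀, h₀, hc₀⟩ fun l hl => length_le_of_count_le hl.2
    refine ⟨ts, isLegal_iff.2 ⟨e, hts⟩, ?_⟩
    let r : Fin G.numTrans → ℕ := fun t => f t - ts.count t
    have hr : ∀ v, G.Balanced r v v := by
      intro v q
      have h1 := he q
      have h2 := hts.balanced q
      have h3 : G.outSum f q = G.outSum r q + G.outSum (fun t => ts.count t) q := by
        rw [outSum, outSum, outSum, ← Finset.sum_add_distrib]
        exact Finset.sum_congr rfl fun t _ => (Nat.sub_add_cancel (hc t)).symm
      have h4 : G.inSum f q = G.inSum r q + G.inSum (fun t => ts.count t) q := by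
        rw [inSum, inSum, inSum, ← Finset.sum_add_distrib]
        exact Finset.sum_congr rfl fun t _ => (Nat.sub_add_cancel (hc t)).symm
      omega
    by_contra! hne
    obtain ⟨t₀, ht₀⟩ := hne
    have hrt₀ : r t₀ ≠ 0 := by have := hc t₀; simp only [r]; omega
    let visited : Fin G.numStates → Prop := fun v =>
      ∃ a b, ts = a ++ b ∧ G.Trail s a v ∧ G.Trail v b e
    have hex : ∃ v t, visited v ∧ (G.src t).1 = v ∧ r t ≠ 0 := by
      by_contra! hno
      have hv : ∀ q, Relation.ReflTransGen (G.StepIn {t | f t ≠ 0}) s q → visited q := by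
        intro q hq
        induction hq with
        | refl => exact ⟨[], ts, rfl, rfl, hts⟩
        | tail _ hstep ih =>
          obtain ⟨t, ht, rfl, rfl⟩ := hstep
          have h1 : r t = 0 := hno _ t ih rfl
          have h2 : 0 < ts.count t := by
            have : f t ≠ 0 := ht
            have : f t - ts.count t = 0 := h1
            omega
          obtain ⟨a, b, hab⟩ := List.append_of_mem (List.count_pos_iff.1 h2)
          rw [hab] at hts
          obtain ⟨m, h3, h4, h5⟩ := trail_append.1 hts
          exact ⟨a ++ [t], b, by simp [hab], trail_append.2 ⟨m, h3, h4, rfl⟩, h5⟩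
      exact hrt₀ (hno _ t₀ (hv _ (hconn t₀ fun h => hrt₀ (by simp [r, h]))) rfl)
    obtain ⟨v, t, ⟨a, b, rfl, ha, hb⟩, rfl, hrt⟩ := hex
    obtain ⟨ts', h1, h2, h3⟩ := exists_maximal_trail (hr (G.src t).1)
    have h4 := hmax (a ++ (ts' ++ b)) ⟨trail_append.2 ⟨_, ha, trail_append.2 ⟨_, h1, hb⟩⟩,
      fun u => ?_⟩
    · have h5 : ts'.length = 0 := by simp only [List.length_append] at h4; omega
      have h6 := h3 t rfl
      rw [List.eq_nil_of_length_eq_zero h5, List.count_nil] at h6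
      exact hrt h6.symm
    · have h5 := h2 u
      have h6 := hc u
      simp only [r, List.count_append] at h5 h6 ⊢
      omega

end Gadget

/-! ### Controlled switching flows and reachability -/

namespace System

variable {G : Gadget} (S : System G)

/-- The connected component of a location. -/
abbrev comp (l : S.Loc) : S.conn.ConnectedComponent := S.conn.connectedComponentMk l

open Classical in
/-- `f` satisfies the conservation law of a flow from `l` to the goal. -/
def Conserves (l : S.Loc) (f : S.Flow) : Prop :=
  ∀ H : S.conn.ConnectedComponent,
    ((∑ g, ∑ t, if S.comp (g, (G.src t).2) = H then (f g t : ℤ) else 0) -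
      ∑ g, ∑ t, if S.comp (g, (G.dst t).2) = H then (f g t : ℤ) else 0) =
    (if S.comp l = H then 1 else 0) - (if S.comp S.goal = H then 1 else 0)

/-- `f` counts the uses of the transitions in legal sequences that begin in the states `σ`. -/
def Realizes (σ : Fin S.numCopies → Fin G.numStates) (f : S.Flow) : Prop :=
  ∀ g, ∃ ts : List (Fin G.numTrans), G.IsLegal (σ g) ts ∧ ∀ t, ts.count t = f g t

theorem isControlledSwitchingFlow_iff (f : S.Flow) :
    S.IsControlledSwitchingFlow f ↔ S.Conserves S.start f ∧ S.Realizes S.init f := Iff.rfl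

variable {S}

/-- One more use of the transition `t` of the copy `g`. -/
def addUse (f : S.Flow) (g : Fin S.numCopies) (t : Fin G.numTrans) : S.Flow :=
  fun g' t' => f g' t' + if g' = g ∧ t' = t then 1 else 0

theorem sum_addUse (P : Fin S.numCopies → Fin G.numTrans → Prop) [∀ g t, Decidable (P g t)]
    (f : S.Flow) (g : Fin S.numCopies) (t : Fin G.numTrans) :
    (∑ g', ∑ t', if P g' t' then (addUse f g t g' t' : ℤ) else 0) =
      (∑ g', ∑ t', if P g' t' then (f g' t' : ℤ) else 0) + if P g t then 1 else 0 := by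
  have h : ∀ g' t', (if P g' t' then (addUse f g t g' t' : ℤ) else 0) =
      (if P g' t' then (f g' t' : ℤ) else 0) +
        if g' = g then (if t' = t then (if P g t then 1 else 0) else 0) else 0 := by
    intro g' t'
    by_cases h1 : g' = g
    · by_cases h2 : t' = t
      · subst h1 h2
        by_cases h3 : P g' t' <;> simp [addUse, h3]
      · by_cases h3 : P g' t' <;> simp [addUse, h2, h3]
    · by_cases h3 : P g' t' <;> simp [addUse, h1, h3]
  simp only [h, Finset.sum_add_distrib]
  congr 1
  rw [Finset.sum_eq_single g (fun g' _ hg => by simp [hg]) (by simp)]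
  simp

theorem conserves_addUse {l : S.Loc} {f : S.Flow} {g : Fin S.numCopies} {t : Fin G.numTrans}
    (hl : S.comp l = S.comp (g, (G.src t).2)) :
    S.Conserves l (addUse f g t) ↔ S.Conserves (g, (G.dst t).2) f := by
  unfold Conserves
  refine forall_congr' fun H => ?_
  rw [sum_addUse, sum_addUse, hl]
  constructor <;> intro h <;> linarith

theorem reach_of_comp_eq {l l' : S.Loc} (h : S.comp l = S.comp l')
    (σ : Fin S.numCopies → Fin G.numStates) : Relation.ReflTransGen S.Step (l, σ) (l', σ) := by
  obtain ⟨w⟩ := SimpleGraph.ConnectedComponent.exact h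
  induction w with
  | nil => exact .refl
  | cons hadj _ ih => exact .head (.wire _ _ _ hadj) (ih (SimpleGraph.ConnectedComponent.sound ⟨‹_›⟩))

theorem reach_of_flow (hG : G.IsSingleInputOutput) : ∀ (N : ℕ) (l : S.Loc)
    (σ : Fin S.numCopies → Fin G.numStates) (f : S.Flow), ∑ g, ∑ t, f g t = N →
    S.Conserves l f → S.Realizes σ f → ∃ σ', Relation.ReflTransGen S.Step (l, σ) (S.goal, σ') := by
  classical
  obtain ⟨a, ha, -⟩ := hG
  have hin : ∀ t, (G.src t).2 = a := fun t => (ha t).1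
  intro N
  induction N using Nat.strong_induction_on with
  | _ N ih =>
  intro l σ f hN hc hr
  by_cases hgoal : S.comp l = S.comp S.goal
  · exact ⟨σ, reach_of_comp_eq hgoal σ⟩
  have hex : ∃ g t, S.comp (g, (G.src t).2) = S.comp l ∧ f g t ≠ 0 := by
    by_contra! hno
    have h1 := hc (S.comp l)
    rw [if_pos rfl, if_neg (Ne.symm hgoal),
      Finset.sum_eq_zero fun g _ => Finset.sum_eq_zero fun t _ => by
        by_cases h : S.comp (g, (G.src t).2) = S.comp l
        · simp [hno g t h]
        · simp [h]] at h1
    have h2 : 0 ≤ ∑ g, ∑ t, if S.comp (g, (G.dst t).2) = S.comp l then (f g t : ℤ) else 0 :=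
      Finset.sum_nonneg fun g _ => Finset.sum_nonneg fun t _ => by split_ifs <;> positivity
    linarith
  obtain ⟨g, t, hgt, hft⟩ := hex
  obtain ⟨ts, hts, hcount⟩ := hr g
  rcases ts with _ | ⟨u, ts⟩
  · exact absurd (hcount t).symm (by simpa using hft)
  obtain ⟨hu, hts⟩ := hts
  let f' : S.Flow := fun g' t' => f g' t' - if g' = g ∧ t' = u then 1 else 0
  have hfu : f g u = ts.count u + 1 := by rw [← hcount u, List.count_cons_self]
  have hf : f = addUse f' g u := by
    funext g' t'
    simp only [addUse, f']
    by_cases h : g' = g ∧ t' = u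
    · rw [if_pos h, h.1, h.2]; omega
    · simp [h]
  have hl : S.comp l = S.comp (g, (G.src u).2) := by rw [← hgt, hin, hin]
  have hlt : ∑ g, ∑ t, f' g t < N := by
    rw [← hN]
    refine Finset.sum_lt_sum (fun g' _ => Finset.sum_le_sum fun t' _ => Nat.sub_le _ _)
      ⟨g, Finset.mem_univ _, Finset.sum_lt_sum (fun t' _ => Nat.sub_le _ _)
        ⟨u, Finset.mem_univ _, ?_⟩⟩
    simp only [f', and_self, if_true]
    omega
  have hc' : S.Conserves (g, (G.dst u).2) f' := (conserves_addUse hl).1 (hf ▸ hc)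
  have hr' : S.Realizes (Function.update σ g (G.dst u).1) f' := by
    intro g'
    by_cases h : g' = g
    · subst h
      refine ⟨ts, by rwa [Function.update_self], fun t' => ?_⟩
      have := hcount t'
      simp only [f', true_and, ← this, List.count_cons, eq_comm (a := t')]
      simp
    · obtain ⟨ts', h1, h2⟩ := hr g'
      refine ⟨ts', by rwa [Function.update_of_ne h], fun t' => ?_⟩
      simp [f', h, h2]
  obtain ⟨σ', h⟩ := ih _ hlt _ _ _ rfl hc' hr'
  exact ⟨σ', (reach_of_comp_eq hl σ).trans (.head (.traverse g u σ hu) h)⟩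

variable (S)

/-- The agent can go from `l` to the goal with the given traversals. -/
def Run : S.Loc → (Fin S.numCopies → Fin G.numStates) →
    List (Fin S.numCopies × Fin G.numTrans) → Prop
  | l, _, [] => S.comp l = S.comp S.goal
  | l, σ, x :: ts => S.comp l = S.comp (x.1, (G.src x.2).2) ∧ (G.src x.2).1 = σ x.1 ∧
      Run (x.1, (G.dst x.2).2) (Function.update σ x.1 (G.dst x.2).1) ts

/-- The copies that are traversed, with the states of all copies before the traversal. -/
def configs : (Fin S.numCopies → Fin G.numStates) → List (Fin S.numCopies × Fin G.numTrans) →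
    List (Fin S.numCopies × (Fin S.numCopies → Fin G.numStates))
  | _, [] => []
  | σ, x :: ts => (x.1, σ) :: configs (Function.update σ x.1 (G.dst x.2).1) ts

variable {S}

theorem length_configs (ts : List (Fin S.numCopies × Fin G.numTrans)) :
    ∀ σ, (S.configs σ ts).length = ts.length := by
  induction ts with
  | nil => intro σ; rfl
  | cons x ts ih => intro σ; simp [configs, ih]

theorem Run.congr {l l' : S.Loc} {σ} {ts} (h : S.Run l σ ts) (hl : S.comp l' = S.comp l) :
    S.Run l' σ ts := by
  rcases ts with _ | ⟨x, ts⟩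
  · exact hl.trans h
  · exact ⟨hl.trans h.1, h.2⟩

theorem exists_run {c : S.Config} {σ'} (h : Relation.ReflTransGen S.Step c (S.goal, σ')) :
    ∃ ts, S.Run c.1 c.2 ts := by
  induction h using Relation.ReflTransGen.head_induction_on with
  | refl => exact ⟨[], rfl⟩
  | head hstep _ ih =>
    obtain ⟨ts, hts⟩ := ih
    cases hstep with
    | wire a b σ hadj => exact ⟨ts, hts.congr (SimpleGraph.ConnectedComponent.sound hadj.reachable)⟩
    | traverse g t σ ht => exact ⟨(g, t) :: ts, rfl, ht, hts⟩

theorem exists_run_of_mem_configs (a : Fin G.numLocs) (hin : ∀ t, (G.src t).2 = a)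
    {g : Fin S.numCopies} {σ} (ts : List (Fin S.numCopies × Fin G.numTrans)) :
    ∀ l σ', S.Run l σ' ts → (S.configs σ' ts).Nodup → (g, σ) ∈ S.configs σ' ts →
      ∃ ts', S.Run (g, a) σ ts' ∧ (S.configs σ ts').Nodup := by
  induction ts with
  | nil => intro l σ' _ _ h; cases h
  | cons x ts ih =>
    intro l σ' hrun hnd hmem
    rcases List.mem_cons.1 hmem with h | h
    · obtain ⟨rfl, rfl⟩ := Prod.mk.inj h
      exact ⟨x :: ts, ⟨by rw [hin], hrun.2⟩, hnd⟩
    · exact ih _ _ hrun.2.2 (List.nodup_cons.1 hnd).2 h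

theorem Run.exists_nodup (a : Fin G.numLocs) (hin : ∀ t, (G.src t).2 = a)
    (ts : List (Fin S.numCopies × Fin G.numTrans)) :
    ∀ {l σ}, S.Run l σ ts → ∃ ts', S.Run l σ ts' ∧ (S.configs σ ts').Nodup := by
  induction ts with
  | nil => intro l σ h; exact ⟨[], h, List.nodup_nil⟩
  | cons x ts ih =>
    rintro l σ ⟨h1, h2, h3⟩
    obtain ⟨ts', h4, h5⟩ := ih h3
    by_cases hmem : (x.1, σ) ∈ S.configs (Function.update σ x.1 (G.dst x.2).1) ts'
    · obtain ⟨ts'', h6, h7⟩ := exists_run_of_mem_configs a hin _ _ _ h4 h5 hmem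
      exact ⟨ts'', h6.congr (by rw [h1, hin]), h7⟩
    · exact ⟨x :: ts', ⟨h1, h2, h4⟩, List.nodup_cons.2 ⟨hmem, h5⟩⟩

theorem Run.conserves (ts : List (Fin S.numCopies × Fin G.numTrans)) :
    ∀ {l σ}, S.Run l σ ts → S.Conserves l (fun g t => ts.count (g, t)) ∧
      S.Realizes σ (fun g t => ts.count (g, t)) := by
  classical
  induction ts with
  | nil =>
    intro l σ h
    refine ⟨fun H => ?_, fun g => ⟨[], trivial, by simp⟩⟩
    rw [show S.comp l = S.comp S.goal from h]
    simp
  | cons x ts ih =>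
    obtain ⟨g, t⟩ := x
    rintro l σ ⟨h1, h2, h3⟩
    obtain ⟨h4, h5⟩ := ih h3
    have e : (fun g' t' => ((g, t) :: ts).count (g', t')) =
        addUse (S := S) (fun g t => ts.count (g, t)) g t := by
      funext g' t'
      simp only [addUse, List.count_cons, beq_iff_eq, Prod.mk.injEq, eq_comm (a := g),
        eq_comm (a := t)]
    rw [e]
    refine ⟨(conserves_addUse h1).2 h4, fun g' => ?_⟩
    obtain ⟨us, h6, h7⟩ := h5 g'
    by_cases h : g' = g
    · subst h
      rw [Function.update_self] at h6
      exact ⟨t :: us, ⟨h2, h6⟩, fun t' => by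
        simp only [addUse, List.count_cons, h7, beq_iff_eq, true_and, eq_comm (a := t)]⟩
    · rw [Function.update_of_ne h] at h6
      exact ⟨us, h6, fun t' => by simp [addUse, h, h7]⟩

theorem exists_flow (hG : G.IsSingleInputOutput) (h : S.GoalReachable) :
    ∃ f, S.IsControlledSwitchingFlow f ∧
      ∀ g t, f g t ≤ S.numCopies * G.numStates ^ S.numCopies := by
  obtain ⟨a, ha, -⟩ := hG
  obtain ⟨σ', h⟩ := h
  obtain ⟨ts₀, h₀⟩ := exists_run h
  obtain ⟨ts, h1, h2⟩ := h₀.exists_nodup a (fun t => (ha t).1)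
  refine ⟨_, h1.conserves, fun g t => List.count_le_length.trans ?_⟩
  have := h2.length_le_card
  rw [length_configs] at this
  simpa using this

end System

/-! ### Lengths of descriptions -/

theorem encodeNat_eq_bits (n : ℕ) : encodeNat n = n.bits := by
  induction n using Nat.binaryRec' with
  | zero => simp [encodeNat, encodeNum]
  | bit b n hn ih =>
    rw [Nat.bits_append_bit n b hn, ← ih]
    unfold encodeNat
    rw [← Num.ofNat'_eq, ← Num.ofNat'_eq, Num.ofNat'_bit]
    have h0 : Num.ofNat' n = 0 → b = true := fun h => hn (by
      have := congrArg (fun m : Num => (m : ℕ)) h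
      simpa [Num.ofNat'_eq] using this)
    generalize Num.ofNat' n = m at h0 ⊢
    rcases m with _ | p
    · obtain rfl := h0 rfl
      rfl
    · cases b <;> rfl

theorem encode_nat (n : ℕ) : encodingNatΓ'.encode n = n.bits.map Γ'.bit := by
  rw [← encodeNat_eq_bits]
  rfl

theorem length_encodeNats_le {l : List ℕ} {m : ℕ} (h : ∀ n ∈ l, n.size ≤ m) :
    (encodeNats l).length ≤ l.length * (m + 1) := by
  induction l with
  | nil => simp [encodeNats]
  | cons n l ih =>
    have h1 := ih fun k hk => h k (List.mem_cons_of_mem _ hk)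
    have h2 := h n List.mem_cons_self
    have h3 : encodeNats (n :: l) = encodingNatΓ'.encode n ++ [Γ'.comma] ++ encodeNats l := rfl
    rw [h3, List.length_append, List.length_append, encode_nat, List.length_map,
      Nat.size_eq_bits_len, List.length_singleton, List.length_cons, Nat.succ_mul]
    omega

theorem length_le_length_encodeNats (l : List ℕ) : l.length ≤ (encodeNats l).length := by
  induction l with
  | nil => simp
  | cons n l ih =>
    have h3 : encodeNats (n :: l) = encodingNatΓ'.encode n ++ [Γ'.comma] ++ encodeNats l := rfl
    rw [h3, List.length_append, List.length_append, List.length_singleton, List.length_cons]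
    omega

namespace System

variable {G : Gadget} (S : System G)

theorem numCopies_le_length_encode : S.numCopies ≤ S.encode.length := by
  refine le_trans ?_ (length_le_length_encodeNats _)
  simp only [toNats, List.length_cons, List.length_append, List.length_ofFn]
  omega

theorem length_encodeFlow_le {f : S.Flow}
    (hf : ∀ g t, f g t ≤ S.numCopies * G.numStates ^ S.numCopies) :
    (S.encodeFlow f).length ≤ S.numCopies * G.numTrans *
      (S.numCopies + G.numStates * S.numCopies + 1) := by
  refine (length_encodeNats_le (m := S.numCopies + G.numStates * S.numCopies)
    fun n hn => ?_).trans (Nat.mul_le_mul_right _ (le_of_eq ?_))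
  · simp only [List.mem_flatten, List.mem_ofFn] at hn
    obtain ⟨_, ⟨g, rfl⟩, hn⟩ := hn
    obtain ⟨t, rfl⟩ := (List.mem_ofFn' _ _).1 hn
    rw [Nat.size_le]
    refine (hf g t).trans_lt ?_
    rw [pow_add, pow_mul]
    exact Nat.mul_lt_mul_of_lt_of_le S.numCopies.lt_two_pow_self
      (Nat.pow_le_pow_left G.numStates.lt_two_pow_self.le _) (by positivity)
  · simp [List.length_flatten, List.map_ofFn, Function.comp_def]

theorem exists_flow_length_le (hG : G.IsSingleInputOutput) :
    ∃ p : Polynomial ℕ, ∀ S : System G, S.GoalReachable → ∃ f, S.IsControlledSwitchingFlow f ∧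
      (∀ g t, f g t ≤ S.numCopies * G.numStates ^ S.numCopies) ∧
      (S.encodeFlow f).length ≤ p.eval S.encode.length := by
  refine ⟨.X * .C G.numTrans * (.X + .C G.numStates * .X + 1), fun S hS => ?_⟩
  obtain ⟨f, hf, hb⟩ := exists_flow hG hS
  refine ⟨f, hf, hb, (S.length_encodeFlow_le hb).trans ?_⟩
  have := S.numCopies_le_length_encode
  simp only [Polynomial.eval_mul, Polynomial.eval_add, Polynomial.eval_X, Polynomial.eval_C,
    Polynomial.eval_one]
  gcongr

end System

/-! ### Connected components by substitution -/

section substAll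

variable {V W C : Type} [DecidableEq V] [DecidableEq W]

/-- Apply a list of replacements to `l`, one after the other. -/
def substAll (s : List (V × V)) (l : V) : V := s.foldl (fun l p => if l = p.1 then p.2 else l) l

/-- The replacements that merge the endpoints of the given edges. -/
def merges (es : List (V × V)) : List (V × V) :=
  es.foldl (fun s e => s ++ [(substAll s e.1, substAll s e.2)]) []

theorem substAll_append_singleton (s : List (V × V)) (p : V × V) (l : V) :
    substAll (s ++ [p]) l = if substAll s l = p.1 then p.2 else substAll s l := by
  unfold substAll
  rw [List.foldl_append]
  rfl

theorem merges_append_singleton (es : List (V × V)) (e : V × V) :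
    merges (es ++ [e]) = merges es ++ [(substAll (merges es) e.1, substAll (merges es) e.2)] := by
  simp [merges]

theorem apply_substAll_merges {c : V → C} (es : List (V × V)) (h : ∀ e ∈ es, c e.1 = c e.2) :
    ∀ l, c (substAll (merges es) l) = c l := by
  induction es using List.reverseRecOn with
  | nil => intro l; rfl
  | append_singleton es e ih =>
    have ih := ih fun e he => h e (List.mem_append_left _ he)
    intro l
    rw [merges_append_singleton, substAll_append_singleton]
    split_ifs with hl
    · dsimp only at hl ⊢
      rw [ih, ← h e (by simp), ← ih e.1, ← hl, ih]
    · exact ih l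

theorem substAll_merges_eq (es : List (V × V)) :
    ∀ e ∈ es, substAll (merges es) e.1 = substAll (merges es) e.2 := by
  induction es using List.reverseRecOn with
  | nil => intro e he; cases he
  | append_singleton es e ih =>
    intro e' he'
    rw [merges_append_singleton, substAll_append_singleton, substAll_append_singleton]
    rcases List.mem_append.1 he' with h | h
    · rw [ih e' h]
    · obtain rfl := List.mem_singleton.1 h
      simp

theorem substAll_map {f : V → W} (hf : Function.Injective f) (s : List (V × V)) :
    ∀ l, substAll (s.map (Prod.map f f)) (f l) = f (substAll s l) := by
  induction s with
  | nil => intro l; rfl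
  | cons p s ih =>
    intro l
    have h := ih (if l = p.1 then p.2 else l)
    unfold substAll at h ⊢
    rw [List.map_cons, List.foldl_cons, List.foldl_cons, ← h]
    congr 1
    simp only [Prod.map_fst, Prod.map_snd, hf.eq_iff]
    split_ifs <;> rfl

theorem merges_map {f : V → W} (hf : Function.Injective f) (es : List (V × V)) :
    merges (es.map (Prod.map f f)) = (merges es).map (Prod.map f f) := by
  induction es using List.reverseRecOn with
  | nil => rfl
  | append_singleton es e ih =>
    rw [List.map_append, List.map_singleton, merges_append_singleton, merges_append_singleton, ih,
      List.map_append]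
    simp [substAll_map hf]

theorem length_merges (es : List (V × V)) : (merges es).length = es.length := by
  induction es using List.reverseRecOn with
  | nil => rfl
  | append_singleton es e ih => simp [merges_append_singleton, ih]

variable {α : Type} [TEnc α] [TEnc V]

theorem sz_substAll_le {s : List (V × V)} {m : ℕ} (hs : ∀ p ∈ s, sz p.2 ≤ m) :
    ∀ {l}, sz l ≤ m → sz (substAll s l) ≤ m := by
  induction s with
  | nil => intro l h; exact h
  | cons p s ih =>
    intro l h
    refine ih (fun q hq => hs q (List.mem_cons_of_mem _ hq)) (l := if l = p.1 then p.2 else l) ?_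
    split_ifs
    · exact hs p List.mem_cons_self
    · exact h

theorem sz_merges_mem_le {es : List (V × V)} {m : ℕ} :
    (∀ e ∈ es, sz e.1 ≤ m ∧ sz e.2 ≤ m) → ∀ p ∈ merges es, sz p.1 ≤ m ∧ sz p.2 ≤ m := by
  induction es using List.reverseRecOn with
  | nil => intro _ p hp; cases hp
  | append_singleton es e ih =>
    intro h p hp
    have ih := ih fun e he => h e (List.mem_append_left _ he)
    rw [merges_append_singleton] at hp
    rcases List.mem_append.1 hp with hp | hp
    · exact ih p hp
    · obtain rfl := List.mem_singleton.1 hp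
      have he := h e (by simp)
      exact ⟨sz_substAll_le (fun p hp => (ih p hp).2) he.1,
        sz_substAll_le (fun p hp => (ih p hp).2) he.2⟩

theorem PT.substAll [PTEq V] {s : α → List (V × V)} {l : α → V} (hs : PT s) (hl : PT l) :
    PT fun a => substAll (s a) (l a) := by
  refine PT.foldl_add (h := fun _ (l : V) (p : V × V) => if l = p.1 then p.2 else l) hs hl
    (PT.ite (PTP.eq PT.snd'.fst PT.snd'.snd.fst) PT.snd'.snd.snd PT.snd'.fst)
    ⟨fun a => sz (s a), hs.pb, fun a l p hp => ?_⟩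
  have := sz_mem_lt hp
  rw [sz_prod] at this
  dsimp only
  split_ifs <;> omega

theorem PT.merges [PTEq V] {es : α → List (V × V)} (hes : PT es) :
    PT fun a => merges (es a) := by
  refine PT.foldl (h := fun _ (s : List (V × V)) (e : V × V) =>
    s ++ [(IOGadget.substAll s e.1, IOGadget.substAll s e.2)]) hes (PT.const [])
    (PT.snd'.fst.append (((PT.substAll PT.snd'.fst PT.snd'.snd.fst).pair
      (PT.substAll PT.snd'.fst PT.snd'.snd.snd)).cons (PT.const [])))
    ⟨fun a => 1 + sz (es a) * (1 + (1 + sz (es a) + sz (es a))), ?_, fun a l₁ l₂ e => ?_⟩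
  · exact (PB.const 1).add (hes.pb.mul ((PB.const 1).add
      (((PB.const 1).add hes.pb).add hes.pb)))
  · change sz (IOGadget.merges l₁) ≤ _
    refine sz_le_of_forall ?_ fun p hp => ?_
    · rw [length_merges]
      have := length_lt_sz (es a)
      rw [e, List.length_append, ← e] at this
      omega
    · have := sz_merges_mem_le (es := l₁) (m := sz (es a)) (fun e' he' => ?_) p hp
      · rw [sz_prod]; omega
      · have := sz_mem_lt (a := e') (l := es a) (by rw [e]; exact List.mem_append_left _ he')
        rw [sz_prod] at this
        omega

end substAll

theorem System.comp_eq_iff {G : Gadget} (S : System G) (l l' : S.Loc) :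
    S.comp l = S.comp l' ↔ substAll (merges S.edges) l = substAll (merges S.edges) l' := by
  have hsound : ∀ l, S.comp (substAll (merges S.edges) l) = S.comp l := by
    refine apply_substAll_merges S.edges fun e he => ?_
    by_cases h : e.1 = e.2
    · rw [h]
    · exact SimpleGraph.ConnectedComponent.sound
        (SimpleGraph.Adj.reachable ((SimpleGraph.fromRel_adj _ _ _).2 ⟨h, .inl he⟩))
  constructor
  · intro h
    obtain ⟨w⟩ := SimpleGraph.ConnectedComponent.exact h
    clear h
    induction w with
    | nil => rfl
    | cons hadj _ ih =>
      rw [← ih]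
      rcases ((SimpleGraph.fromRel_adj _ _ _).1 hadj).2 with h | h
      · exact substAll_merges_eq _ _ h
      · exact (substAll_merges_eq _ _ h).symm
  · intro h
    rw [← hsound l, h, hsound]

/-! ### Reading descriptions -/

noncomputable instance : TEnc Γ' := ⟨fun c => enc (Fintype.equivFin Γ' c : ℕ)⟩

noncomputable instance : TEnc (Γ' ⊕ Γ') := ⟨fun c => enc (Fintype.equivFin (Γ' ⊕ Γ') c : ℕ)⟩

theorem PT.of_symbol {β : Type} [TEnc β] (f : Γ' → β) : PT f :=
  PT.of_finite (fun c => (Fintype.equivFin Γ' c : ℕ))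
    (Fin.val_injective.comp (Equiv.injective _)) (fun _ => rfl) f

theorem PT.of_sum_symbol {β : Type} [TEnc β] (f : Γ' ⊕ Γ' → β) : PT f :=
  PT.of_finite (fun c => (Fintype.equivFin (Γ' ⊕ Γ') c : ℕ))
    (Fin.val_injective.comp (Equiv.injective _)) (fun _ => rfl) f

instance : PTEq Γ' :=
  ⟨(PTP.eq ((PT.of_symbol fun c => (Fintype.equivFin Γ' c : ℕ)).comp PT.fst')
    ((PT.of_symbol fun c => (Fintype.equivFin Γ' c : ℕ)).comp PT.snd')).of_iff fun x => by
      rw [Fin.val_inj, Equiv.apply_eq_iff_eq]⟩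

section parse

variable {α : Type} [TEnc α]

/-- The digits are read from the right to the left; a comma begins a new number. -/
def parseStep (l : List ℕ) (c : Γ') : List ℕ :=
  if c = .comma then 0 :: l
  else if l = [] then []
  else Nat.bit (sectionΓ'Bool c) (l.headD 0) :: l.tail

/-- The list of numbers that is described by a string. -/
def parseNats (x : List Γ') : List ℕ := x.reverse.foldl parseStep []

theorem encodeNats_cons (n : ℕ) (l : List ℕ) :
    encodeNats (n :: l) = n.bits.map Γ'.bit ++ Γ'.comma :: encodeNats l := by
  rw [← encode_nat]
  simp [encodeNats]

theorem parseNats_encodeNats (l : List ℕ) : parseNats (encodeNats l) = l := by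
  unfold parseNats
  rw [List.foldl_reverse]
  induction l with
  | nil => rfl
  | cons n l ih =>
    rw [encodeNats_cons, List.foldr_append, List.foldr_cons, ih]
    have : ∀ bs : List Bool, List.foldr (fun x y => parseStep y x) (parseStep l .comma)
        (bs.map Γ'.bit) = bs.foldr Nat.bit 0 :: l := by
      intro bs
      induction bs with
      | nil => simp [parseStep]
      | cons b bs ih => rw [List.map_cons, List.foldr_cons, ih]; simp [parseStep, sectionΓ'Bool]
    rw [this, bits_foldr]

theorem PT.parseNats {x : α → List Γ'} (hx : PT x) : PT fun a => parseNats (x a) := by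
  refine PT.foldl_add (h := fun _ => parseStep) hx.reverse (PT.const []) ?_
    ⟨fun _ => 4, PB.const 4, fun a l c _ => ?_⟩
  · exact PT.ite (PTP.eq PT.snd'.snd (PT.const _)) ((PT.const 0).cons PT.snd'.fst)
      (PT.ite (PTP.isEmpty PT.snd'.fst) (PT.const [])
        ((((PT.of_symbol sectionΓ'Bool).comp PT.snd'.snd).bit
          (PT.snd'.fst.headD (PT.const 0))).cons PT.snd'.fst.tail))
  · unfold parseStep
    dsimp only
    split_ifs with h1 h2
    · rw [sz_cons, sz_zero]; omega
    · subst h2; simp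
    · obtain ⟨n, r, rfl⟩ := List.exists_cons_of_ne_nil h2
      have := sz_bit_le (sectionΓ'Bool c) n
      simp only [List.headD_cons, List.tail_cons, sz_cons]
      omega

theorem PT.encodeNats {l : α → List ℕ} (hl : PT l) : PT fun a => encodeNats (l a) := by
  have hbit : PT Γ'.bit := PT.bool_cases (f := fun b _ => Γ'.bit b) PT.id (PT.const _) (PT.const _)
  refine (PT.flatMap (h := fun _ n => n.bits.map Γ'.bit ++ [Γ'.comma]) hl
    ((PT.map (h := fun _ b => Γ'.bit b) PT.snd'.bits (hbit.comp PT.snd')).append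
      (PT.const _))).of_enc_eq fun a => ?_
  simp only [IOGadget.encodeNats, encode_nat]

/-- Group a list of numbers in pairs of pairs. -/
def chunk : List ℕ → List ((ℕ × ℕ) × (ℕ × ℕ))
  | a :: b :: c :: d :: l => ((a, b), (c, d)) :: chunk l
  | _ => []

/-- The list of numbers in a list of pairs of pairs. -/
def unchunk (es : List ((ℕ × ℕ) × (ℕ × ℕ))) : List ℕ :=
  es.flatMap fun e => [e.1.1, e.1.2, e.2.1, e.2.2]

theorem chunk_unchunk (es : List ((ℕ × ℕ) × (ℕ × ℕ))) : chunk (unchunk es) = es := by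
  induction es with
  | nil => rfl
  | cons e es ih =>
    change (e.1, e.2) :: chunk (unchunk es) = _
    rw [ih]

/-- Move four numbers from the first list to the second. -/
def chunkStep (s : List ℕ × List ((ℕ × ℕ) × (ℕ × ℕ))) : List ℕ × List ((ℕ × ℕ) × (ℕ × ℕ)) :=
  if s.1.tail.tail.tail = [] then s
  else (s.1.tail.tail.tail.tail, ((s.1.headD 0, s.1.tail.headD 0),
    (s.1.tail.tail.headD 0, s.1.tail.tail.tail.headD 0)) :: s.2)

theorem chunkStep_iterate (i : ℕ) : ∀ (l : List ℕ) (o : List ((ℕ × ℕ) × (ℕ × ℕ))),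
    l.length ≤ i → (chunkStep^[i] (l, o)).2.reverse = o.reverse ++ chunk l := by
  induction i with
  | zero =>
    intro l o h
    rw [List.length_eq_zero_iff.1 (Nat.le_zero.1 h)]
    simp [chunk]
  | succ i ih =>
    intro l o h
    rw [Function.iterate_succ_apply]
    match l with
    | a :: b :: c :: d :: l =>
      have : chunkStep (a :: b :: c :: d :: l, o) = (l, ((a, b), (c, d)) :: o) := by
        simp [chunkStep]
      rw [this, ih _ _ (by simp only [List.length_cons] at h; omega)]
      simp [chunk]
    | [] | [_] | [_, _] | [_, _, _] =>
      have : ∀ l, List.tail (List.tail (List.tail l)) = [] → chunkStep (l, o) = (l, o) :=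
        fun l hl => if_pos hl
      rw [this _ rfl, Function.iterate_fixed (this _ rfl)]
      simp [chunk]

theorem PT.chunk {l : α → List ℕ} (hl : PT l) : PT fun a => chunk (l a) := by
  have hstep : PT chunkStep := by
    have h0 : PT fun s : List ℕ × List ((ℕ × ℕ) × (ℕ × ℕ)) => s.1 := PT.fst'
    exact PT.ite (PTP.isEmpty h0.tail.tail.tail) PT.id (h0.tail.tail.tail.tail.pair
      ((((h0.headD (PT.const 0)).pair (h0.tail.headD (PT.const 0))).pair
        ((h0.tail.tail.headD (PT.const 0)).pair
          (h0.tail.tail.tail.headD (PT.const 0)))).cons PT.snd'))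
  have hfold : PT fun a => (l a).foldl (fun s _ => chunkStep s) (l a, []) := by
    refine PT.foldl_add (h := fun _ s _ => chunkStep s) hl (hl.pair (PT.const []))
      (hstep.comp PT.snd'.fst) ⟨fun _ => 0, PB.const 0, fun a s _ _ => ?_⟩
    obtain ⟨l, o⟩ := s
    match l with
    | a :: b :: c :: d :: l =>
      have : chunkStep (a :: b :: c :: d :: l, o) = (l, ((a, b), (c, d)) :: o) := by
        simp [chunkStep]
      rw [this]
      simp only [sz_prod, sz_cons]
      omega
    | [] | [_] | [_, _] | [_, _, _] => exact le_of_eq (congrArg sz (if_pos rfl))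
  refine hfold.snd.reverse.of_enc_eq fun a => ?_
  rw [foldl_const, chunkStep_iterate _ _ _ le_rfl]
  rfl

end parse

/-! ### Deciding controlled switching flows -/

/-- The number of copies in a described system. -/
def nCopies (L : List ℕ) : ℕ := L.getD 0 0

/-- The copies in a described system. -/
def copies (L : List ℕ) : List ℕ := List.range (min L.length (nCopies L))

/-- The initial state of a copy in a described system. -/
def initial (L : List ℕ) (g : ℕ) : ℕ := L.getD (g + 1) 0

/-- The start location of a described system. -/
def startLoc (L : List ℕ) : ℕ × ℕ := (L.getD (nCopies L + 1) 0, L.getD (nCopies L + 2) 0)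

/-- The goal location of a described system. -/
def goalLoc (L : List ℕ) : ℕ × ℕ := (L.getD (nCopies L + 3) 0, L.getD (nCopies L + 4) 0)

/-- The edges of a described system. -/
def edgeList (L : List ℕ) : List ((ℕ × ℕ) × (ℕ × ℕ)) := chunk (L.drop (nCopies L + 5))

/-- A location that represents the connected component of `l` in a described system. -/
def rep (L : List ℕ) (l : ℕ × ℕ) : ℕ × ℕ := substAll (merges (edgeList L)) l

namespace Gadget

variable (G : Gadget)

/-- The number of uses of a transition of a copy in a described flow. -/
def uses (F : List ℕ) (g : ℕ) (t : Fin G.numTrans) : ℕ := F.getD (G.numTrans * g + t) 0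

/-- `l` is a location in a described system. -/
def IsLoc (L : List ℕ) (l : ℕ × ℕ) : Prop :=
  (∃ g ∈ copies L, l.1 = g) ∧ ∃ a : Fin G.numLocs, l.2 = a

/-- The lists of numbers describe a system and a flow. -/
def WellFormed (L F : List ℕ) : Prop :=
  L.drop (nCopies L + 4) ≠ [] ∧ unchunk (edgeList L) = L.drop (nCopies L + 5) ∧
    (∀ g ∈ copies L, ∃ s : Fin G.numStates, initial L g = s) ∧ G.IsLoc L (startLoc L) ∧
    G.IsLoc L (goalLoc L) ∧ (∀ e ∈ edgeList L, G.IsLoc L e.1 ∧ G.IsLoc L e.2) ∧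
    F.length = G.numTrans * nCopies L

/-- The number of uses of transitions whose end `o` is in the component of `l`. -/
def compSum (o : Fin G.numTrans → Fin G.numLocs) (L F : List ℕ) (l : ℕ × ℕ) : ℕ :=
  ((copies L).map fun g => ∑ t, if rep L (g, o t) = rep L l then G.uses F g t else 0).sum

/-- The described flow satisfies the conservation law. -/
def ConservesCode (L F : List ℕ) : Prop :=
  ∀ g ∈ copies L, ∀ a : Fin G.numLocs,
    G.compSum (fun t => (G.src t).2) L F (g, a) +
        (if rep L (goalLoc L) = rep L (g, a) then 1 else 0) =
      G.compSum (fun t => (G.dst t).2) L F (g, a) +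
        if rep L (startLoc L) = rep L (g, a) then 1 else 0

/-- The described flow is realized by legal sequences of transitions. -/
def RealizesCode (L F : List ℕ) : Prop :=
  ∀ g ∈ copies L, ∃ s : Fin G.numStates, ∃ U : Fin G.numTrans → Bool,
    (∀ t, U t = true → Relation.ReflTransGen (G.StepIn {t | U t = true}) s (G.src t).1) ∧
    initial L g = s ∧ (∀ t, U t = true ↔ G.uses F g t ≠ 0) ∧
    ∃ e, G.Balanced (G.uses F g) s e

section

variable {α : Type} [TEnc α] {L F : α → List ℕ} {g : α → ℕ}

theorem pt_nCopies (hL : PT L) : PT fun a => nCopies (L a) := hL.getD (PT.const 0) (PT.const 0)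

theorem pt_copies (hL : PT L) : PT fun a => copies (L a) := hL.range_min (pt_nCopies hL)

theorem pt_initial (hL : PT L) (hg : PT g) : PT fun a => initial (L a) (g a) :=
  hL.getD (hg.add (PT.const 1)) (PT.const 0)

theorem pt_startLoc (hL : PT L) : PT fun a => startLoc (L a) :=
  (hL.getD ((pt_nCopies hL).add (PT.const 1)) (PT.const 0)).pair
    (hL.getD ((pt_nCopies hL).add (PT.const 2)) (PT.const 0))

theorem pt_goalLoc (hL : PT L) : PT fun a => goalLoc (L a) :=
  (hL.getD ((pt_nCopies hL).add (PT.const 3)) (PT.const 0)).pair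
    (hL.getD ((pt_nCopies hL).add (PT.const 4)) (PT.const 0))

theorem pt_edgeList (hL : PT L) : PT fun a => edgeList (L a) :=
  (hL.drop ((pt_nCopies hL).add (PT.const 5))).chunk

theorem pt_rep {l : α → ℕ × ℕ} (hL : PT L) (hl : PT l) : PT fun a => rep (L a) (l a) :=
  PT.substAll (pt_edgeList hL).merges hl

theorem pt_uses (hF : PT F) (hg : PT g) (t : Fin G.numTrans) : PT fun a => G.uses (F a) (g a) t :=
  hF.getD ((PT.const_mul _ hg).add (PT.const _)) (PT.const 0)

theorem ptp_isLoc {l : α → ℕ × ℕ} (hL : PT L) (hl : PT l) : PTP fun a => G.IsLoc (L a) (l a) :=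
  (PTP.exists_mem (P := fun a g => (l a).1 = g) (pt_copies hL)
    (PTP.eq (hl.comp PT.fst').fst PT.snd')).and
    (PTP.exists fun _ => PTP.eq hl.snd (PT.const _))

theorem pt_unchunk {l : α → List ((ℕ × ℕ) × (ℕ × ℕ))} (hl : PT l) :
    PT fun a => unchunk (l a) :=
  PT.flatMap (h := fun (_ : α) (e : (ℕ × ℕ) × (ℕ × ℕ)) => [e.1.1, e.1.2, e.2.1, e.2.2]) hl
    (PT.snd'.fst.fst.cons (PT.snd'.fst.snd.cons (PT.snd'.snd.fst.cons
      (PT.snd'.snd.snd.cons (PT.const [])))))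

theorem ptp_wellFormed (hL : PT L) (hF : PT F) : PTP fun a => G.WellFormed (L a) (F a) := by
  refine (PTP.isEmpty (hL.drop ((pt_nCopies hL).add (PT.const 4)))).not.and
    ((PTP.eq (pt_unchunk (pt_edgeList hL)) (hL.drop ((pt_nCopies hL).add (PT.const 5)))).and
    (PTP.and (PTP.forall_mem (P := fun a g => ∃ s : Fin G.numStates, initial (L a) g = s)
      (pt_copies hL) (PTP.exists fun s => PTP.eq (pt_initial (hL.comp PT.fst') PT.snd')
        (PT.const _)))
    ((G.ptp_isLoc hL (pt_startLoc hL)).and ((G.ptp_isLoc hL (pt_goalLoc hL)).and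
    (PTP.and (PTP.forall_mem (P := fun a e => G.IsLoc (L a) e.1 ∧ G.IsLoc (L a) e.2)
      (pt_edgeList hL) ((G.ptp_isLoc (hL.comp PT.fst') PT.snd'.fst).and
        (G.ptp_isLoc (hL.comp PT.fst') PT.snd'.snd)))
    (PTP.eq hF.length (PT.const_mul _ (pt_nCopies hL))))))))

theorem pt_compSum (o : Fin G.numTrans → Fin G.numLocs) {l : α → ℕ × ℕ} (hL : PT L) (hF : PT F)
    (hl : PT l) : PT fun a => G.compSum o (L a) (F a) (l a) := by
  refine PT.sum (PT.map (h := fun a g => ∑ t, if rep (L a) (g, o t) = rep (L a) (l a) then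
    G.uses (F a) g t else 0) (pt_copies hL) (PT.finset_sum _ fun t => ?_))
  exact PT.ite (PTP.eq (pt_rep (hL.comp PT.fst') (PT.snd'.pair (PT.const _)))
    (pt_rep (hL.comp PT.fst') (hl.comp PT.fst'))) (G.pt_uses (hF.comp PT.fst') PT.snd' t)
    (PT.const 0)

theorem ptp_conservesCode (hL : PT L) (hF : PT F) : PTP fun a => G.ConservesCode (L a) (F a) := by
  refine PTP.forall_mem (P := fun a g => ∀ b : Fin G.numLocs,
    G.compSum (fun t => (G.src t).2) (L a) (F a) (g, b) +
        (if rep (L a) (goalLoc (L a)) = rep (L a) (g, b) then 1 else 0) =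
      G.compSum (fun t => (G.dst t).2) (L a) (F a) (g, b) +
        if rep (L a) (startLoc (L a)) = rep (L a) (g, b) then 1 else 0)
    (pt_copies hL) (PTP.forall fun b => ?_)
  have hL' : PT fun x : α × ℕ => L x.1 := hL.comp PT.fst'
  have hF' : PT fun x : α × ℕ => F x.1 := hF.comp PT.fst'
  have hl : PT fun x : α × ℕ => (x.2, (b : ℕ)) := PT.snd'.pair (PT.const _)
  exact PTP.eq
    ((G.pt_compSum _ hL' hF' hl).add (PT.ite (PTP.eq (pt_rep hL' (pt_goalLoc hL')) (pt_rep hL' hl))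
      (PT.const 1) (PT.const 0)))
    ((G.pt_compSum _ hL' hF' hl).add (PT.ite (PTP.eq (pt_rep hL' (pt_startLoc hL')) (pt_rep hL' hl))
      (PT.const 1) (PT.const 0)))

theorem ptp_realizesCode (hL : PT L) (hF : PT F) : PTP fun a => G.RealizesCode (L a) (F a) := by
  have hF' : ∀ t, PT fun x : α × ℕ => G.uses (F x.1) x.2 t := fun t =>
    G.pt_uses (hF.comp PT.fst') PT.snd' t
  refine PTP.forall_mem (P := fun a g => ∃ s : Fin G.numStates, ∃ U : Fin G.numTrans → Bool,
    (∀ t, U t = true → Relation.ReflTransGen (G.StepIn {t | U t = true}) s (G.src t).1) ∧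
    initial (L a) g = s ∧ (∀ t, U t = true ↔ G.uses (F a) g t ≠ 0) ∧
    ∃ e, G.Balanced (G.uses (F a) g) s e) (pt_copies hL)
    (PTP.exists fun s => PTP.exists fun U => (PTP.const _).and
      ((PTP.eq (pt_initial (hL.comp PT.fst') PT.snd') (PT.const _)).and
      ((PTP.forall fun t => (PTP.const _).iff (PTP.eq (hF' t) (PT.const 0)).not).and
      (PTP.exists fun e => PTP.forall fun q => PTP.eq ?_ ?_))))
  · exact (PT.finset_sum _ fun t => hF' t).add (PT.const _)
  · exact (PT.finset_sum _ fun t => hF' t).add (PT.const _)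

end

end Gadget

/-! ### Correctness of the description of the checks -/

namespace System

variable {G : Gadget} (S : System G)

/-- The numbers that describe a flow. -/
def flowNats (f : S.Flow) : List ℕ := (List.ofFn fun g => List.ofFn fun t => f g t).flatten

/-- A location as a pair of numbers. -/
def locNats (l : S.Loc) : ℕ × ℕ := (l.1, l.2)

theorem locNats_injective : Function.Injective S.locNats := fun _ _ h =>
  Prod.ext (Fin.ext (Prod.mk.inj h).1) (Fin.ext (Prod.mk.inj h).2)

theorem nCopies_toNats : nCopies S.toNats = S.numCopies := rfl

theorem copies_toNats : copies S.toNats = List.range S.numCopies := by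
  unfold copies
  rw [nCopies_toNats, min_eq_right]
  simp only [toNats, List.length_cons, List.length_append, List.length_ofFn]
  omega

theorem initial_toNats (g : Fin S.numCopies) : initial S.toNats g = S.init g := by
  simp [initial, toNats, List.getElem?_append]

theorem drop_toNats (i : ℕ) : S.toNats.drop (S.numCopies + i + 1) =
    ([(S.start.1 : ℕ), (S.start.2 : ℕ), (S.goal.1 : ℕ), (S.goal.2 : ℕ)] ++
      S.edges.flatMap fun e => [(e.1.1 : ℕ), (e.1.2 : ℕ), (e.2.1 : ℕ), (e.2.2 : ℕ)]).drop i := by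
  simp only [toNats, List.drop_succ_cons, List.append_assoc]
  rw [← List.drop_drop, List.drop_left' (by simp)]

theorem getD_toNats (i : ℕ) : S.toNats.getD (S.numCopies + i + 1) 0 =
    ([(S.start.1 : ℕ), (S.start.2 : ℕ), (S.goal.1 : ℕ), (S.goal.2 : ℕ)] ++
      S.edges.flatMap fun e => [(e.1.1 : ℕ), (e.1.2 : ℕ), (e.2.1 : ℕ), (e.2.2 : ℕ)]).getD i 0 := by
  have h : ∀ (l : List ℕ) i, l.getD i 0 = (l.drop i).headD 0 := fun l i => by
    rw [List.headD_eq_head?_getD, List.head?_drop, List.getD_eq_getElem?_getD]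
  rw [h, h, drop_toNats]

theorem startLoc_toNats : startLoc S.toNats = S.locNats S.start :=
  Prod.ext (S.getD_toNats 0) (S.getD_toNats 1)

theorem goalLoc_toNats : goalLoc S.toNats = S.locNats S.goal :=
  Prod.ext (S.getD_toNats 2) (S.getD_toNats 3)

theorem unchunk_edges : (S.edges.flatMap fun e =>
    [(e.1.1 : ℕ), (e.1.2 : ℕ), (e.2.1 : ℕ), (e.2.2 : ℕ)]) =
      unchunk (S.edges.map (Prod.map S.locNats S.locNats)) := by
  simp [unchunk, List.flatMap_map, locNats]

theorem edgeList_toNats : edgeList S.toNats = S.edges.map (Prod.map S.locNats S.locNats) := by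
  unfold edgeList
  rw [nCopies_toNats, drop_toNats S 4, unchunk_edges]
  exact chunk_unchunk _

theorem rep_toNats (l : S.Loc) :
    rep S.toNats (S.locNats l) = S.locNats (substAll (merges S.edges) l) := by
  rw [rep, edgeList_toNats, merges_map S.locNats_injective, substAll_map S.locNats_injective]

theorem rep_toNats_eq_iff (l l' : S.Loc) :
    rep S.toNats (S.locNats l) = rep S.toNats (S.locNats l') ↔ S.comp l = S.comp l' := by
  rw [rep_toNats, rep_toNats, S.locNats_injective.eq_iff, comp_eq_iff]

theorem isLoc_toNats (l : S.Loc) : G.IsLoc S.toNats (S.locNats l) := by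
  rw [Gadget.IsLoc, copies_toNats]
  exact ⟨⟨l.1, by simp, rfl⟩, l.2, rfl⟩

theorem getD_flatten {α : Type} {T : ℕ} {d : α} {ll : List (List α)} {t : ℕ}
    (h : ∀ l ∈ ll, l.length = T) (ht : t < T) :
    ∀ g, ll.flatten.getD (T * g + t) d = (ll.getD g []).getD t d := by
  induction ll with
  | nil => intro g; simp
  | cons l ll ih =>
    have hl := h l List.mem_cons_self
    rintro (_ | g)
    · rw [List.flatten_cons, mul_zero, zero_add, List.getD_append _ _ _ _ (by omega),
        List.getD_cons_zero]
    · rw [List.flatten_cons, List.getD_append_right _ _ _ _ (by rw [hl]; nlinarith),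
        List.getD_cons_succ, ← ih (fun l hl => h l (List.mem_cons_of_mem _ hl))]
      congr 1
      rw [hl, Nat.mul_succ]
      omega

theorem uses_flowNats (f : S.Flow) (g : Fin S.numCopies) (t : Fin G.numTrans) :
    G.uses (S.flowNats f) g t = f g t := by
  rw [Gadget.uses, flowNats, getD_flatten (T := G.numTrans) (by simp) t.2]
  simp

theorem length_flowNats (f : S.Flow) : (S.flowNats f).length = G.numTrans * S.numCopies := by
  simp [flowNats, List.length_flatten, List.map_ofFn, Function.comp_def, mul_comm]

theorem wellFormed_toNats (f : S.Flow) : G.WellFormed S.toNats (S.flowNats f) := by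
  refine ⟨?_, ?_, ?_, ?_, ?_, ?_, S.length_flowNats f⟩
  · rw [nCopies_toNats, drop_toNats S 3]
    simp
  · rw [edgeList_toNats, nCopies_toNats, drop_toNats S 4, unchunk_edges]
    rfl
  · intro g hg
    rw [copies_toNats, List.mem_range] at hg
    exact ⟨_, S.initial_toNats ⟨g, hg⟩⟩
  · rw [startLoc_toNats]; exact S.isLoc_toNats _
  · rw [goalLoc_toNats]; exact S.isLoc_toNats _
  · rw [edgeList_toNats]
    intro e he
    obtain ⟨e, -, rfl⟩ := List.mem_map.1 he
    exact ⟨S.isLoc_toNats _, S.isLoc_toNats _⟩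

theorem sum_map_range (n : ℕ) (h : ℕ → ℕ) : ((List.range n).map h).sum = ∑ i : Fin n, h i := by
  rw [← Finset.sum_range]
  induction n with
  | zero => rfl
  | succ n ih => rw [List.range_succ, Finset.sum_range_succ, List.map_append, List.sum_append, ih]; simp

theorem compSum_toNats [DecidableEq S.conn.ConnectedComponent]
    (o : Fin G.numTrans → Fin G.numLocs) (f : S.Flow) (l : S.Loc) :
    G.compSum o S.toNats (S.flowNats f) (S.locNats l) =
      ∑ g, ∑ t, if S.comp (g, o t) = S.comp l then f g t else 0 := by
  rw [Gadget.compSum, copies_toNats, sum_map_range]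
  refine Finset.sum_congr rfl fun g _ => Finset.sum_congr rfl fun t _ => ?_
  rw [uses_flowNats]
  exact if_congr (S.rep_toNats_eq_iff (g, o t) l) rfl rfl

theorem conservesCode_iff (f : S.Flow) :
    G.ConservesCode S.toNats (S.flowNats f) ↔ S.Conserves S.start f := by
  classical
  have key : ∀ l : S.Loc,
      (G.compSum (fun t => (G.src t).2) S.toNats (S.flowNats f) (S.locNats l) +
        (if rep S.toNats (goalLoc S.toNats) = rep S.toNats (S.locNats l) then 1 else 0) =
      G.compSum (fun t => (G.dst t).2) S.toNats (S.flowNats f) (S.locNats l) +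
        if rep S.toNats (startLoc S.toNats) = rep S.toNats (S.locNats l) then 1 else 0) ↔
      ((∑ g, ∑ t, if S.comp (g, (G.src t).2) = S.comp l then (f g t : ℤ) else 0) -
        ∑ g, ∑ t, if S.comp (g, (G.dst t).2) = S.comp l then (f g t : ℤ) else 0) =
      (if S.comp S.start = S.comp l then 1 else 0) -
        (if S.comp S.goal = S.comp l then 1 else 0) := by
    intro l
    rw [compSum_toNats, compSum_toNats, goalLoc_toNats, startLoc_toNats]
    simp only [rep_toNats_eq_iff]
    rw [← Nat.cast_inj (R := ℤ)]
    push_cast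
    constructor <;> intro h <;> linarith
  unfold Gadget.ConservesCode Conserves
  rw [copies_toNats]
  constructor
  · intro h H
    induction H using SimpleGraph.ConnectedComponent.ind with
    | _ l =>
    have := (key l).1 (h l.1 (List.mem_range.2 l.1.2) l.2)
    convert this
  · intro h g hg a
    have := (key (⟨g, List.mem_range.1 hg⟩, a)).2 (by convert h (S.comp (⟨g, List.mem_range.1 hg⟩, a)))
    exact this

theorem realizesCode_iff (f : S.Flow) :
    G.RealizesCode S.toNats (S.flowNats f) ↔ S.Realizes S.init f := by
  unfold Gadget.RealizesCode Realizes
  rw [copies_toNats]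
  have huses : ∀ g : Fin S.numCopies, G.uses (S.flowNats f) g = f g := fun g =>
    funext fun t => S.uses_flowNats f g t
  constructor
  · intro h g
    obtain ⟨s, U, h1, h2, h3, h4⟩ := h g (List.mem_range.2 g.2)
    rw [initial_toNats] at h2
    obtain rfl := Fin.ext h2
    rw [huses] at h3 h4
    have hU : {t | U t = true} = {t | f g t ≠ 0} := Set.ext h3
    rw [hU] at h1
    exact (Gadget.exists_isLegal_count_iff _ _).2 ⟨h4, fun t ht => h1 t ((h3 t).2 ht)⟩
  · intro h g hg
    lift g to Fin S.numCopies using List.mem_range.1 hg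
    obtain ⟨h1, h2⟩ := (Gadget.exists_isLegal_count_iff _ _).1 (h g)
    rw [huses]
    refine ⟨S.init g, fun t => decide (f g t ≠ 0), ?_, S.initial_toNats g, by simp, h1⟩
    simpa using h2

theorem isControlledSwitchingFlow_iff_code (f : S.Flow) :
    S.IsControlledSwitchingFlow f ↔ G.ConservesCode S.toNats (S.flowNats f) ∧
      G.RealizesCode S.toNats (S.flowNats f) := by
  rw [conservesCode_iff, realizesCode_iff, isControlledSwitchingFlow_iff]

end System

theorem list_eq_of_drop_ne_nil {L : List ℕ} {n : ℕ} (h : L.drop (n + 4) ≠ []) :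
    L = L.getD 0 0 :: ((List.ofFn fun g : Fin n => L.getD (g + 1) 0) ++
      [L.getD (n + 1) 0, L.getD (n + 2) 0, L.getD (n + 3) 0, L.getD (n + 4) 0] ++
      L.drop (n + 5)) := by
  have hlen : n + 4 < L.length := by
    by_contra hc
    exact h (List.drop_eq_nil_of_le (by omega))
  have hget : ∀ i (hi : i < L.length), L.getD i 0 = L[i] := fun i hi => by
    simp [List.getD_eq_getElem?_getD, hi]
  rw [List.append_assoc]
  refine List.ext_getElem ?_ fun i h1 h2 => ?_
  · simp only [List.length_cons, List.length_append, List.length_ofFn, List.length_drop,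
      List.length_nil]
    omega
  · rw [← hget i h1]
    rcases i with _ | i
    · rfl
    · rw [List.getElem_cons_succ]
      by_cases hi : i < n
      · rw [List.getElem_append_left (by simpa using hi), List.getElem_ofFn]
      · obtain ⟨j, rfl⟩ := Nat.exists_eq_add_of_le (not_lt.1 hi)
        rw [List.getElem_append_right (by simp)]
        simp only [List.length_ofFn, Nat.add_sub_cancel_left]
        match j with
        | 0 | 1 | 2 | 3 => rfl
        | j + 4 =>
          rw [hget _ h1]
          simp only [List.cons_append, List.nil_append, List.getElem_cons_succ, List.getElem_drop]
          congr 1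
          omega

theorem exists_system_of_wellFormed {G : Gadget} {L F : List ℕ} (h : G.WellFormed L F) :
    ∃ (S : System G) (f : S.Flow), S.toNats = L ∧ S.flowNats f = F := by
  obtain ⟨h1, h2, h3, h4, h5, h6, h7⟩ := h
  have hL := list_eq_of_drop_ne_nil h1
  set n := nCopies L with hn
  have hcop : ∀ g, g ∈ copies L ↔ g < n := by
    intro g
    have : n + 4 < L.length := by
      by_contra hc
      exact h1 (List.drop_eq_nil_of_le (by omega))
    rw [copies, List.mem_range, ← hn]
    omega
  have hloc : ∀ l, G.IsLoc L l → ∃ l' : Fin n × Fin G.numLocs, ((l'.1 : ℕ), (l'.2 : ℕ)) = l := by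
    rintro ⟨g, a⟩ ⟨⟨g', hg, rfl⟩, b, rfl⟩
    exact ⟨(⟨g, (hcop g).1 hg⟩, b), rfl⟩
  obtain ⟨st, hst⟩ := hloc _ h4
  obtain ⟨gl, hgl⟩ := hloc _ h5
  have h3' : ∀ g : Fin n, ∃ s : Fin G.numStates, initial L g = s := fun g => h3 g ((hcop g).2 g.2)
  choose s hs using h3'
  obtain ⟨es, hes⟩ : ∃ es : List ((Fin n × Fin G.numLocs) × (Fin n × Fin G.numLocs)),
      es.map (fun e => (((e.1.1 : ℕ), (e.1.2 : ℕ)), ((e.2.1 : ℕ), (e.2.2 : ℕ)))) = edgeList L := by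
    have : edgeList L ∈ Set.range (List.map fun e : (Fin n × Fin G.numLocs) ×
        (Fin n × Fin G.numLocs) => (((e.1.1 : ℕ), (e.1.2 : ℕ)), ((e.2.1 : ℕ), (e.2.2 : ℕ)))) := by
      rw [Set.range_list_map]
      intro e he
      obtain ⟨a, ha⟩ := hloc _ (h6 e he).1
      obtain ⟨b, hb⟩ := hloc _ (h6 e he).2
      exact ⟨(a, b), Prod.ext ha hb⟩
    exact this
  let S : System G := ⟨n, fun g => s g, st, gl, es⟩
  have hstart : (List.ofFn fun g : Fin n => ((s g : Fin G.numStates) : ℕ)) =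
      List.ofFn fun g : Fin n => L.getD (g + 1) 0 := by
    congr 1
    funext g
    exact (hs g).symm
  refine ⟨S, fun g t => G.uses F g t, ?_, ?_⟩
  · have he : unchunk (edgeList L) =
        es.flatMap fun e => [(e.1.1 : ℕ), (e.1.2 : ℕ), (e.2.1 : ℕ), (e.2.2 : ℕ)] := by
      rw [← hes]
      simp [unchunk, List.flatMap_map]
    have a1 := congrArg Prod.fst hst
    have a2 := congrArg Prod.snd hst
    have a3 := congrArg Prod.fst hgl
    have a4 := congrArg Prod.snd hgl
    simp only [startLoc, goalLoc, ← hn] at a1 a2 a3 a4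
    conv_rhs => rw [hL]
    rw [← h2, he, ← hstart, ← a1, ← a2, ← a3, ← a4]
    rfl
  · refine List.ext_getElem ?_ fun i hi hi' => ?_
    · rw [h7]; exact S.length_flowNats _
    · have hT : 0 < G.numTrans := by
        rcases Nat.eq_zero_or_pos G.numTrans with h0 | h0
        · rw [h7, h0] at hi'; omega
        · exact h0
      have hg : i / G.numTrans < n := Nat.div_lt_of_lt_mul (by rw [← h7]; exact hi')
      have ht : i % G.numTrans < G.numTrans := Nat.mod_lt _ hT
      have := S.uses_flowNats (fun g t => G.uses F g t) ⟨i / G.numTrans, hg⟩ ⟨i % G.numTrans, ht⟩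
      simp only [Gadget.uses, Nat.div_add_mod] at this
      rw [List.getD_eq_getElem _ _ hi'] at this
      exact (List.getD_eq_getElem _ _ hi).symm.trans this

/-! ### The verifier -/

/-- The strings `x` and `w` describe a system and a controlled switching flow in it. -/
def Verifies (G : Gadget) (x : List Γ' × List Γ') : Prop :=
  ∃ (S : System G) (f : S.Flow), S.encode = x.1 ∧ S.encodeFlow f = x.2 ∧
    S.IsControlledSwitchingFlow f

theorem verifies_iff (G : Gadget) (x w : List Γ') :
    Verifies G (x, w) ↔ encodeNats (parseNats x) = x ∧ encodeNats (parseNats w) = w ∧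
      G.WellFormed (parseNats x) (parseNats w) ∧ G.ConservesCode (parseNats x) (parseNats w) ∧
      G.RealizesCode (parseNats x) (parseNats w) := by
  constructor
  · rintro ⟨S, f, h1, h2, hf⟩
    dsimp only at h1 h2
    have hx : parseNats x = S.toNats := by rw [← h1, System.encode, parseNats_encodeNats]
    have hw : parseNats w = S.flowNats f := by
      rw [← h2, System.encodeFlow, parseNats_encodeNats, System.flowNats]
    rw [hx, hw]
    exact ⟨h1, h2, S.wellFormed_toNats f, (S.isControlledSwitchingFlow_iff_code f).1 hf⟩
  · rintro ⟨h1, h2, h3, h4⟩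
    obtain ⟨S, f, hS, hf⟩ := exists_system_of_wellFormed h3
    rw [← hS, ← hf] at h4
    exact ⟨S, f, by rw [System.encode, hS, h1],
      by rw [System.encodeFlow, ← System.flowNats, hf, h2],
      (S.isControlledSwitchingFlow_iff_code f).2 h4⟩

/-- The first string in a pair of strings. -/
def leftPart (l : List (Γ' ⊕ Γ')) : List Γ' := l.flatMap (Sum.elim (fun c => [c]) fun _ => [])

/-- The second string in a pair of strings. -/
def rightPart (l : List (Γ' ⊕ Γ')) : List Γ' := l.flatMap (Sum.elim (fun _ => []) fun c => [c])

theorem leftPart_pairString (x : List Γ' × List Γ') : leftPart (pairString x) = x.1 := by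
  simp [leftPart, pairString, List.flatMap_map]

theorem rightPart_pairString (x : List Γ' × List Γ') : rightPart (pairString x) = x.2 := by
  simp [rightPart, pairString, List.flatMap_map]

theorem ptp_verifies (G : Gadget) :
    PTP fun l : List (Γ' ⊕ Γ') => Verifies G (leftPart l, rightPart l) := by
  have hx : PT fun l : List (Γ' ⊕ Γ') => leftPart l :=
    PT.flatMap (h := fun _ => Sum.elim (fun c => [c]) fun _ => []) PT.id
      ((PT.of_sum_symbol (Sum.elim (fun c => [c]) fun _ => [])).comp PT.snd')
  have hw : PT fun l : List (Γ' ⊕ Γ') => rightPart l :=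
    PT.flatMap (h := fun _ => Sum.elim (fun _ => []) fun c => [c]) PT.id
      ((PT.of_sum_symbol (Sum.elim (fun _ => []) fun c => [c])).comp PT.snd')
  exact ((PTP.eq hx.parseNats.encodeNats hx).and ((PTP.eq hw.parseNats.encodeNats hw).and
    ((G.ptp_wellFormed hx.parseNats hw.parseNats).and
      ((G.ptp_conservesCode hx.parseNats hw.parseNats).and
        (G.ptp_realizesCode hx.parseNats hw.parseNats))))).of_iff
    fun l => verifies_iff G _ _

/-- Predicates of strings that are decided by stack programs in polynomial time are decided by
Turing machines in polynomial time. -/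
theorem PTP.polyTimeDecidable {A : Type} [Fintype A] [TEnc A] {P : List A → Prop} (hP : PTP P)
    {α : Type} (e : α → List A) : PolyTimeDecidable e fun a => P (e a) := by
  obtain ⟨f, hf, hfP⟩ := hP
  obtain ⟨-, c, T, ⟨p, hp⟩, hc⟩ := hf.comp (PT.reverse PT.id)
  let m : ℕ := ∑ a : A, sz a
  have hm : ∀ a : A, sz a ≤ m := fun a =>
    Finset.single_le_sum (f := fun a : A => sz a) (fun _ _ => Nat.zero_le _) (Finset.mem_univ a)
  refine polyTimeDecidable_of_runs (fun a => (true :: code a).reverse)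
    (.seq c (.case .main .skip
      (.case .main .skip .skip (.case .main .skip .skip (.push .main true)))
      (.push .main false))) e _ (p.comp (1 + .X * (1 + .C m)) + 6) fun a => ?_
  refine ⟨f (e a), hfP _, ?_⟩
  have hread : ∀ (l : List A) (l' : List A),
      l.foldl (fun M a => (true :: code a).reverse.reverse ++ M) (code l') =
        code (l.reverse ++ l') := by
    intro l
    induction l with
    | nil => intro l'; rfl
    | cons a l ih =>
      intro l'
      have := ih (a :: l')
      rw [code_cons] at this
      rw [List.foldl_cons, List.reverse_reverse, List.reverse_cons, List.append_assoc,
        List.singleton_append, ← this]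
      rfl
  have hread' := hread (e a) []
  rw [code_nil, List.append_nil] at hread'
  rw [hread']
  have h1 := hc (e a).reverse [] [] [] []
  dsimp only at h1
  rw [List.append_nil, List.append_nil, List.reverse_reverse] at h1
  have h2 : RunsIn (.case .main .skip
      (.case .main .skip .skip (.case .main .skip .skip (.push .main true)))
      (.push .main false)) ⟨code (f (e a)), [], [], []⟩ 4 ⟨[f (e a)], [], [], []⟩ := by
    cases f (e a)
    · exact (RunsIn.case_false rfl (RunsIn.push _ _ _)).mono (by omega)
    · exact RunsIn.case_true rfl (RunsIn.case_false rfl (RunsIn.case_false rfl (RunsIn.push _ _ _)))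
  obtain ⟨n, hn, h3⟩ := h1.seq h2
  refine ⟨n, hn.trans ?_, h3⟩
  have h4 := hp (e a).reverse
  have h5 : sz (e a).reverse ≤ 1 + (e a).length * (1 + m) :=
    sz_le_of_forall (by simp) fun a _ => hm a
  have h6 := h4.trans (polynomial_eval_mono p h5)
  simp only [Polynomial.eval_add, Polynomial.eval_comp, Polynomial.eval_mul, Polynomial.eval_X,
    Polynomial.eval_C, Polynomial.eval_one, Polynomial.eval_ofNat]
  omega

theorem polyTimeDecidable_of_iff {α Γ : Type} {e : α → List Γ} {P Q : α → Prop}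
    (h : PolyTimeDecidable e P) (hPQ : ∀ a, Q a ↔ P a) : PolyTimeDecidable e Q := by
  rwa [show Q = P from funext fun a => propext (hPQ a)]

theorem polyTimeDecidable_verifies (G : Gadget) : PolyTimeDecidable pairString (Verifies G) :=
  polyTimeDecidable_of_iff ((ptp_verifies G).polyTimeDecidable pairString) fun x => by
    rw [leftPart_pairString, rightPart_pairString]

theorem polyTimeDecidable_isControlledSwitchingFlow (G : Gadget) :
    PolyTimeDecidable (encodeSystemFlow (G := G)) fun x => x.1.IsControlledSwitchingFlow x.2 :=
  polyTimeDecidable_of_iff ((ptp_verifies G).polyTimeDecidable encodeSystemFlow) fun x => by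
    rw [encodeSystemFlow, leftPart_pairString, rightPart_pairString]
    constructor
    · exact fun h => ⟨x.1, x.2, rfl, rfl, h⟩
    · rintro ⟨S, f, hS, hf, h⟩
      obtain ⟨S', f'⟩ := x
      obtain rfl := System.encode_injective hS
      obtain rfl := S.encodeFlow_injective hf
      exact h

theorem goalReachable_of_flow {G : Gadget} (hG : G.IsSingleInputOutput) (S : System G)
    (h : ∃ f, S.IsControlledSwitchingFlow f) : S.GoalReachable := by
  obtain ⟨f, hf⟩ := h
  exact System.reach_of_flow hG _ _ _ f rfl hf.1 hf.2

end IOGadget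

theorem mainTheorem6 (G : Gadget) (hG : G.IsSingleInputOutput) :
    InNP (onePlayerMotionPlanning G) ∧
    PolyTimeDecidable (encodeSystemFlow (G := G))
      (fun x => x.1.IsControlledSwitchingFlow x.2) ∧
    (∀ S : System G, (∃ f, S.IsControlledSwitchingFlow f) → S.GoalReachable) ∧
    (∃ p : Polynomial ℕ, ∀ S : System G, S.GoalReachable →
      ∃ f, S.IsControlledSwitchingFlow f ∧
        (∀ g t, f g t ≤ S.numCopies * G.numStates ^ S.numCopies) ∧
        (S.encodeFlow f).length ≤ p.eval S.encode.length) := by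
  obtain ⟨p, hp⟩ := System.exists_flow_length_le hG
  refine ⟨⟨Computability.Γ', inferInstance, Verifies G, p, polyTimeDecidable_verifies G,
    fun x => ⟨?_, ?_⟩⟩, polyTimeDecidable_isControlledSwitchingFlow G,
    goalReachable_of_flow hG, p, hp⟩
  · rintro ⟨S, rfl, hS⟩
    obtain ⟨f, hf, -, hlen⟩ := hp S hS
    exact ⟨S.encodeFlow f, hlen, S, f, rfl, rfl, hf⟩
  · rintro ⟨w, -, S, f, hS, -, hf⟩
    exact ⟨S, hS, goalReachable_of_flow hG S ⟨f, hf⟩⟩
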